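/- Work on the torus $\mathbb T^3=\mathbb R^3/(2\pi\mathbb Z)^3$, and write $\hat u(k)=(2\pi)^{-3}u(e^{-\imath k\cdot x})$, $k\in\mathbb Z^3$, for the Fourier coefficients of a distribution $u\in\mathcal S'(\mathbb T^3)$. Let $(\chi,\theta)$ be a dyadic partition of unity on $\mathbb R^3$: $\chi,\theta$ are smooth, nonnegative and radial, $\operatorname{supp}\chi$ lies in a ball and $\operatorname{supp}\theta$ in an annulus, $\chi(z)+\sum_{j\ge 0}\theta(2^{-j}z)=1$ for all $z$, $\operatorname{supp}\chi\cap\operatorname{supp}\theta(2^{-j}\cdot)=\emptyset$ for $j\ge1$, and $\operatorname{supp}\theta(2^{-i}\cdot)\cap\operatorname{supp}\theta(2^{-j}\cdot)=\emptyset$ for $|i-j|>1$. Set $\Delta_{-1}u=\sum_{k}\chi(k)\hat u(k)e^{\imath k\cdot x}$ and $\Delta_ju=\sum_k\theta(2^{-j}k)\hat u(k)e^{\imath k\cdot x}$ for $j\ge0$. For $\beta\in\mathbb R$ and a vector $u=(u^1,\dots,u^n)$ of distributions put $\|u\|_\beta=\sum_{i=1}^n\sup_{j\ge-1}2^{j\beta}\|\Delta_ju^i\|_{L^\infty(\mathbb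 T^3)}$, and $\mathcal C^\beta=\{u:\|u\|_\beta<\infty\}$. Let $L_0>0$ and let $\tilde f:\mathbb R^3\to[0,\infty)$ be even with $\tilde f(0)=1$. Suppose that on the cube $\{|x^1|,|x^2|,|x^3|\le 3L_0\}$ the function $\tilde f$ is bounded below by a constant $c_f>0$ and, away from the origin, is $C^5$ with $|D_k\tilde f(x)|\lesssim |x|^{1-|k|}+1$ for all multi-indices $|k|\le5$. Let $f=\tilde f$ on $\{|x^1|,|x^2|,|x^3|\le L_0\}$ and $f=\infty$ elsewhere. For $\varepsilon\in(0,1)$ and $t>0$ define $P^\varepsilon_t=e^{t\Delta_\varepsilon}$ by $$\widehat{P^\varepsilon_tu}(k)=e^{-t|k|^2f(\varepsilon k)}\,\hat u(k),\qquad k\in\mathbb Z^3,\qquad e^{-\infty}=0,$$ acting componentwise on vectors. **Lemma 3.4.** Let $\alpha\in\mathbb R$, $0<\delta\le2$ and $\kappa>0$. There is a constant $C>0$, depending only on $\alpha,\delta,\kappa,\chi,\theta,L_0$ and $\tilde f$, such that for every $u\in\mathcal C^{\alpha+\delta}$, every $\varepsilon\in(0,1)$ and all $t>s>0$ $$\|(P^\varepsilon_t-P^\varepsilon_s)u\|_{\alpha-\kappa}\le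 C\,(t-s)^{\delta/2}\,\|u\|_{\alpha+\delta}.$$ -/

import Mathlib

open Set MeasureTheory
open scoped ENNReal ContDiff

noncomputable section

namespace TorusBesov

/-- Three-dimensional Euclidean space. The torus is `ℝ³ / (2πℤ)³`; functions on it are
`2π`-periodic functions on `ℝ³`. -/
abbrev E3 : Type := EuclideanSpace ℝ (Fin 3)

/-- The integer lattice, which indexes the Fourier modes of the torus. -/
abbrev Z3 : Type := Fin 3 → ℤ

/-- A lattice point as a vector of `ℝ³`. -/
def latticePt (k : Z3) : E3 := WithLp.toLp 2 (fun i => (k i : ℝ))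

/-- The closed cube `{x : |x¹|, |x²|, |x³| ≤ r}`. -/
def cube (r : ℝ) : Set E3 := {x | ∀ i, |x i| ≤ r}

/-- The box `[0, 2π]³`, a fundamental domain of the torus up to a null set. -/
def fundBox : Set E3 := {x | ∀ i, x i ∈ Icc (0 : ℝ) (2 * Real.pi)}

/-- `C^∞(𝕋³; ℂ)`: the smooth functions on `ℝ³` that are `2π`-periodic in every coordinate. -/
def testFunctions : Submodule ℂ (E3 → ℂ) where
  carrier := {φ | ContDiff ℝ ∞ φ ∧
    ∀ (x : E3) (m : Z3), φ (x + (2 * Real.pi) • latticePt m) = φ x}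
  add_mem' := by
    rintro φ ψ ⟨h1, h2⟩ ⟨h3, h4⟩
    exact ⟨h1.add h3, fun x m => by simp [h2 x m, h4 x m]⟩
  zero_mem' := ⟨contDiff_const, fun _ _ => rfl⟩
  smul_mem' := by
    rintro c φ ⟨h1, h2⟩
    exact ⟨contDiff_const.smul h1, fun x m => by simp [h2 x m]⟩

/-- `𝒮'(𝕋³)`: the linear functionals `u` on `C^∞(𝕋³; ℂ)` that are continuous, i.e.
`|u(φ)| ≤ C max_{n ≤ N} sup_x |Dⁿφ(x)|` for some `N` and `C`. (Real-valued distributions are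
those with `u(conj φ) = conj (u φ)`.) -/
def distributions : Submodule ℂ (testFunctions →ₗ[ℂ] ℂ) where
  carrier := {u | ∃ (N : ℕ) (C : ℝ), ∀ (φ : testFunctions) (M : ℝ),
    (∀ n ≤ N, ∀ x : E3, ‖iteratedFDeriv ℝ n (φ : E3 → ℂ) x‖ ≤ M) → ‖u φ‖ ≤ C * M}
  add_mem' := by
    rintro u v ⟨N, C, h⟩ ⟨N', C', h'⟩
    refine ⟨max N N', C + C', fun φ M hM => ?_⟩
    have h1 := h φ M fun n hn x => hM n (hn.trans (le_max_left _ _)) x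
    have h2 := h' φ M fun n hn x => hM n (hn.trans (le_max_right _ _)) x
    calc ‖(u + v) φ‖ ≤ ‖u φ‖ + ‖v φ‖ := norm_add_le _ _
      _ ≤ (C + C') * M := by linarith
  zero_mem' := ⟨0, 0, fun φ M _ => by simp⟩
  smul_mem' := by
    rintro c u ⟨N, C, h⟩
    refine ⟨N, ‖c‖ * C, fun φ M hM => ?_⟩
    have h1 := h φ M hM
    calc ‖(c • u) φ‖ = ‖c‖ * ‖u φ‖ := by simp
      _ ≤ ‖c‖ * (C * M) := by gcongr
      _ = ‖c‖ * C * M := by ring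

lemma isCompact_fundBox : IsCompact fundBox := by
  have h : fundBox = (EuclideanSpace.equiv (Fin 3) ℝ).toHomeomorph ⁻¹'
      (Set.univ.pi fun _ => Icc (0 : ℝ) (2 * Real.pi)) := by
    ext x
    simp [fundBox, Pi.le_def, forall_and]
  rw [h]
  exact (Homeomorph.isCompact_preimage _).2 (isCompact_univ_pi fun _ => isCompact_Icc)

lemma integrableOn_mul (ψ φ : testFunctions) :
    IntegrableOn (fun x => (ψ : E3 → ℂ) x * (φ : E3 → ℂ) x) fundBox :=
  (ψ.2.1.continuous.mul φ.2.1.continuous).continuousOn.integrableOn_compact isCompact_fundBox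

/-- A smooth function `ψ` on the torus as the distribution `φ ↦ ∫_{𝕋³} ψ φ dx`. -/
def toDistribution (ψ : testFunctions) : distributions where
  val :=
    { toFun := fun φ => ∫ x in fundBox, (ψ : E3 → ℂ) x * (φ : E3 → ℂ) x
      map_add' := fun φ₁ φ₂ => by
        rw [← integral_add (integrableOn_mul ψ φ₁) (integrableOn_mul ψ φ₂)]
        simp [mul_add]
      map_smul' := fun c φ => by
        rw [RingHom.id_apply, smul_eq_mul, ← integral_const_mul]
        congr 1
        ext x
        simp only [Submodule.coe_smul, Pi.smul_apply, smul_eq_mul]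
        ring }
  property := by
    refine ⟨0, ∫ x in fundBox, ‖(ψ : E3 → ℂ) x‖, fun φ M hM => ?_⟩
    have hφ : ∀ x, ‖(φ : E3 → ℂ) x‖ ≤ M := fun x => by
      simpa using hM 0 le_rfl x
    have hψ : IntegrableOn (fun x => ‖(ψ : E3 → ℂ) x‖) fundBox :=
      ψ.2.1.continuous.norm.continuousOn.integrableOn_compact isCompact_fundBox
    rw [← integral_mul_const]
    refine norm_integral_le_of_norm_le (hψ.mul_const M) (ae_of_all _ fun x => ?_)
    rw [norm_mul]
    exact mul_le_mul_of_nonneg_left (hφ x) (norm_nonneg _)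

/-- The Fourier mode `e_k(x) = exp(i k·x)`. -/
def mode (k : Z3) : testFunctions where
  val := fun x => Complex.exp (Complex.I * ((inner ℝ (latticePt k) x : ℝ) : ℂ))
  property := by
    refine ⟨?_, fun x m => ?_⟩
    · have h : ContDiff ℝ ∞ fun x : E3 => ((inner ℝ (latticePt k) x : ℝ) : ℂ) :=
        Complex.ofRealCLM.contDiff.comp (contDiff_const.inner ℝ contDiff_id)
      exact (contDiff_const.mul h).cexp
    · rw [Complex.exp_eq_exp_iff_exists_int]
      refine ⟨∑ i, k i * m i, ?_⟩
      rw [inner_add_right, inner_smul_right]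
      simp only [latticePt, PiLp.inner_apply, RCLike.inner_apply, conj_trivial, Fin.sum_univ_three]
      push_cast
      ring

/-- The Fourier coefficient `û(k) = (2π)⁻³ u(e_{-k})`, so that `u = ∑ₖ û(k) e_k`. -/
def fourierCoeff (u : distributions) (k : Z3) : ℂ :=
  (((2 * Real.pi) ^ 3 : ℝ) : ℂ)⁻¹ * (u : testFunctions →ₗ[ℂ] ℂ) (mode (-k))

/-- The Fourier multiplier `m(D)u = ∑ₖ m(k) û(k) e_k` for a finitely supported symbol `m`; it is a
trigonometric polynomial. (It is applied to finitely supported symbols only.) -/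
def fourierMultiplier (m : Z3 → ℝ) (u : distributions) : testFunctions :=
  ∑ᶠ k : Z3, ((m k : ℂ) * fourierCoeff u k) • mode k

/-- `(χ, θ)` is a dyadic partition of unity on `ℝ³`. -/
structure IsDyadicPartition (χ θ : E3 → ℝ) : Prop where
  contDiff_low : ContDiff ℝ ∞ χ
  contDiff_high : ContDiff ℝ ∞ θ
  nonneg_low : ∀ x, 0 ≤ χ x
  nonneg_high : ∀ x, 0 ≤ θ x
  radial_low : ∀ x y, ‖x‖ = ‖y‖ → χ x = χ y
  radial_high : ∀ x y, ‖x‖ = ‖y‖ → θ x = θ y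
  ball_low : ∃ R : ℝ, tsupport χ ⊆ {x | ‖x‖ ≤ R}
  annulus_high : ∃ a b : ℝ, 0 < a ∧ tsupport θ ⊆ {x | a ≤ ‖x‖ ∧ ‖x‖ ≤ b}
  /-- `χ(z) + ∑_{j ≥ 0} θ(2⁻ʲ z) = 1`. -/
  sum_eq_one : ∀ z, HasSum (fun j : ℕ => θ (((2 : ℝ) ^ j)⁻¹ • z)) (1 - χ z)
  disjoint_low : ∀ j : ℕ, 1 ≤ j →
    Disjoint (tsupport χ) (tsupport fun x => θ (((2 : ℝ) ^ j)⁻¹ • x))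
  disjoint_high : ∀ i j : ℕ, i + 1 < j →
    Disjoint (tsupport fun x => θ (((2 : ℝ) ^ i)⁻¹ • x))
      (tsupport fun x => θ (((2 : ℝ) ^ j)⁻¹ • x))

/-- The symbol of the Littlewood–Paley block `Δ_j`: `χ` for `j = -1` and `θ(2⁻ʲ ·)` for `j ≥ 0`,
restricted to the lattice. -/
def blockSymbol (χ θ : E3 → ℝ) (j : ℤ) (k : Z3) : ℝ :=
  if j = -1 then χ (latticePt k) else θ (((2 : ℝ) ^ j)⁻¹ • latticePt k)

/-- The Littlewood–Paley block `Δ_j u`, `j ≥ -1`, a trigonometric polynomial. -/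
def block (χ θ : E3 → ℝ) (j : ℤ) (u : distributions) : testFunctions :=
  fourierMultiplier (blockSymbol χ θ j) u

/-- The `L^∞(𝕋³)` norm of a smooth (in particular continuous) function. -/
def supNorm (φ : testFunctions) : ℝ≥0∞ := ⨆ x : E3, ‖(φ : E3 → ℂ) x‖ₑ

/-- The norm of `𝒞^β = B^β_{∞,∞}(𝕋³, ℂⁿ)` with values in `[0, ∞]`:
`‖u‖_β = ∑ᵢ sup_{j ≥ -1} 2^{jβ} ‖Δ_j uⁱ‖_{L^∞}`. -/
def besovNorm (χ θ : E3 → ℝ) (β : ℝ) {n : ℕ} (u : Fin n → distributions) : ℝ≥0∞ :=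
  ∑ i, ⨆ (j : ℤ) (_ : -1 ≤ j),
    ENNReal.ofReal ((2 : ℝ) ^ ((j : ℝ) * β)) * supNorm (block χ θ j (u i))

/-- `u ∈ 𝒞^β`. -/
def MemHolderBesov (χ θ : E3 → ℝ) (β : ℝ) {n : ℕ} (u : Fin n → distributions) : Prop :=
  besovNorm χ θ β u < ⊤

/-- The assumptions on the function `f̃ : ℝ³ → [0, ∞)` of the discretised Laplacian. -/
structure IsAdmissible (L₀ : ℝ) (ft : E3 → ℝ) : Prop where
  nonneg : ∀ x, 0 ≤ ft x
  even : ∀ x, ft (-x) = ft x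
  apply_zero : ft 0 = 1
  /-- The derivatives up to order five exist on the cube, except possibly at the origin. -/
  contDiffAt : ∀ x ∈ cube (3 * L₀), x ≠ 0 → ContDiffAt ℝ 5 ft x
  /-- `|Dⁿf̃(x)| ≲ |x|^{1-n} + 1` for `n ≤ 5`. -/
  deriv_bound : ∃ C : ℝ, ∀ n : ℕ, n ≤ 5 → ∀ x ∈ cube (3 * L₀), x ≠ 0 →
    ‖iteratedFDeriv ℝ n ft x‖ ≤ C * (‖x‖ ^ (1 - (n : ℤ)) + 1)
  lower_bound : ∃ c : ℝ, 0 < c ∧ ∀ x ∈ cube (3 * L₀), c ≤ ft x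

open Classical in
/-- The function `f`: equal to `f̃` on the cube of half-side `L₀`, and to `∞` outside. -/
def cutoff (L₀ : ℝ) (ft : E3 → ℝ) (x : E3) : EReal :=
  if x ∈ cube L₀ then (ft x : EReal) else ⊤

/-- The symbol `exp(-t |k|² f(εk))` of `exp(tΔ_ε)`, with `exp(-∞) = 0`. -/
def semigroupSymbol (L₀ : ℝ) (ft : E3 → ℝ) (ε t : ℝ) (k : Z3) : ℝ :=
  (EReal.exp (-(((t * ‖latticePt k‖ ^ 2 : ℝ) : EReal) *
    cutoff L₀ ft (ε • latticePt k)))).toReal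

/-- The approximated heat semigroup `P_t^ε = exp(tΔ_ε)` on `𝒮'(𝕋³)`, for `ε, t > 0`. -/
def approxSemigroup (L₀ : ℝ) (ft : E3 → ℝ) (ε t : ℝ) (u : distributions) : distributions :=
  toDistribution (fourierMultiplier (semigroupSymbol L₀ ft ε t) u)

end TorusBesov

end

/-! On a dyadic block the operator `P_t - P_s` is a Fourier multiplier, and everything reduces to
bounding its norm on `L^∞` by `C 2^{j(κ+δ)} (t-s)^{δ/2}`, uniformly in `ε` (`multBound_block`).
Indeed, only neighbouring blocks overlap, so `Δ_j (P_t - P_s) u` is this multiplier applied to a sum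
of at most three blocks of `u`, whose supremum is at most a multiple of `2^{-j(α+δ)} ‖u‖_{α+δ}`
(`norm_trigSum_block_le`), and the powers of `2^j` cancel against the weight `2^{j(α-κ)}`.

For `j ≥ 0` and `N = 2^j` the symbol factors as the indicator of a cube times `Φ(k/N)`, where `Φ`
uses `f̃` in place of `f` together with a smooth cutoff. On the annulus carrying `θ` the exponent
`|y|² f̃(εN y)` stays in a compact subset of `(0, ∞)`, with derivatives up to order two bounded
uniformly in `εN`. Interpolating between boundedness and Lipschitz continuity in time gives `Φ` a
`C²` bound of order `((t-s) N²)^{δ/2}` (`derivBound_heatSymbol`).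

Two derivatives suffice in dimension three, because `2 > 3/2`: Parseval with a weight controls the
`L¹` norm of the kernel (`multBound_of_second_difference`). The sharp cube is a product of three
one-dimensional cutoffs, whose Dirichlet kernels have `L¹` norms growing slower than any power
(`multBound_cube_cutoff`); this is the only source of the loss `κ`. For `j = -1` only finitely many
modes occur and a crude estimate is enough (`multBound_low_block`). -/

noncomputable section

namespace TorusBesov

/-! ### Fourier modes in coordinates and their orthogonality -/

/-- The Fourier mode `exp(i k·y)` as a function of the coordinates. -/
def trigMode (k : Z3) (y : Fin 3 → ℝ) : ℂ :=
  Complex.exp (Complex.I * ((∑ a, (k a : ℝ) * y a : ℝ) : ℂ))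

lemma trigMode_eq_prod (k : Z3) (y : Fin 3 → ℝ) :
    trigMode k y = ∏ a, Complex.exp (Complex.I * (((k a : ℝ) * y a : ℝ) : ℂ)) := by
  rw [trigMode, ← Complex.exp_sum, Complex.ofReal_sum, Finset.mul_sum]

lemma norm_trigMode (k : Z3) (y : Fin 3 → ℝ) : ‖trigMode k y‖ = 1 := by
  rw [trigMode, mul_comm, Complex.norm_exp_ofReal_mul_I]

lemma trigMode_add_index (k l : Z3) (y : Fin 3 → ℝ) :
    trigMode (k + l) y = trigMode k y * trigMode l y := by
  rw [trigMode, trigMode, trigMode, ← Complex.exp_add, ← mul_add, ← Complex.ofReal_add,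
    ← Finset.sum_add_distrib]
  simp [add_mul]

lemma trigMode_add (k : Z3) (x y : Fin 3 → ℝ) :
    trigMode k (x + y) = trigMode k x * trigMode k y := by
  rw [trigMode, trigMode, trigMode, ← Complex.exp_add, ← mul_add, ← Complex.ofReal_add,
    ← Finset.sum_add_distrib]
  simp [mul_add]

lemma trigMode_neg_index (k : Z3) (y : Fin 3 → ℝ) : trigMode (-k) y = trigMode k (-y) := by
  simp [trigMode]

lemma conj_trigMode (k : Z3) (y : Fin 3 → ℝ) :
    (starRingEnd ℂ) (trigMode k y) = trigMode (-k) y := by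
  simp [trigMode, ← Complex.exp_conj]

@[fun_prop]
lemma continuous_trigMode (k : Z3) : Continuous (trigMode k) := by
  unfold trigMode
  fun_prop

lemma mode_toLp (k : Z3) (y : Fin 3 → ℝ) :
    (mode k : E3 → ℂ) (WithLp.toLp 2 y) = trigMode k y := by
  simp only [mode, trigMode, latticePt, PiLp.inner_apply, RCLike.inner_apply, conj_trivial]
  congr 4
  ext a
  ring

/-- The box `[c, c + 2π]³`. -/
def box (c : ℝ) : Set (Fin 3 → ℝ) := Set.univ.pi fun _ => Icc c (c + 2 * Real.pi)

lemma isCompact_box (c : ℝ) : IsCompact (box c) := isCompact_univ_pi fun _ => isCompact_Icc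

lemma measurableSet_box (c : ℝ) : MeasurableSet (box c) := (isCompact_box c).measurableSet

lemma integral_exp_int_mul (n : ℤ) (c : ℝ) :
    ∫ y in Icc c (c + 2 * Real.pi), Complex.exp (Complex.I * (((n : ℝ) * y : ℝ) : ℂ)) =
      if n = 0 then ((2 * Real.pi : ℝ) : ℂ) else 0 := by
  have hle : c ≤ c + 2 * Real.pi := by linarith [Real.pi_pos]
  rw [integral_Icc_eq_integral_Ioc, ← intervalIntegral.integral_of_le hle]
  split_ifs with h
  · subst h
    simp
  · have hc : Complex.I * (n : ℂ) ≠ 0 := by simp [h]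
    have := integral_exp_mul_complex (a := c) (b := c + 2 * Real.pi) hc
    push_cast at this ⊢
    simp_rw [← mul_assoc]
    rw [this]
    have h2 : Complex.exp (Complex.I * n * (c + 2 * Real.pi)) = Complex.exp (Complex.I * n * c) := by
      rw [Complex.exp_eq_exp_iff_exists_int]
      exact ⟨n, by ring⟩
    rw [h2, sub_self, zero_div]

lemma integral_trigMode (k : Z3) (c : ℝ) :
    ∫ y in box c, trigMode k y = if k = 0 then (((2 * Real.pi) ^ 3 : ℝ) : ℂ) else 0 := by
  simp_rw [trigMode_eq_prod]
  rw [box, volume_pi, Measure.restrict_pi_pi,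
    integral_fintype_prod_eq_prod
      (f := fun a (y : ℝ) => Complex.exp (Complex.I * (((k a : ℝ) * y : ℝ) : ℂ)))]
  simp_rw [integral_exp_int_mul]
  split_ifs with h
  · subst h
    simp
  · obtain ⟨a, ha⟩ := Function.ne_iff.1 h
    exact Finset.prod_eq_zero (Finset.mem_univ a) (if_neg ha)

/-! ### Fourier multipliers on `L^∞` -/

/-- Pointwise multiplication of Fourier coefficients by `m` is bounded by `A` in the supremum norm
on trigonometric polynomials. -/
def MultBound (m : Z3 → ℂ) (A : ℝ) : Prop :=
  ∀ (s : Finset Z3) (c : Z3 → ℂ) (B : ℝ), (∀ y, ‖∑ k ∈ s, c k * trigMode k y‖ ≤ B) →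
    ∀ y, ‖∑ k ∈ s, m k * c k * trigMode k y‖ ≤ A * B

lemma MultBound.mul {m₁ m₂ : Z3 → ℂ} {A₁ A₂ : ℝ} (h₁ : MultBound m₁ A₁) (h₂ : MultBound m₂ A₂) :
    MultBound (fun k => m₁ k * m₂ k) (A₁ * A₂) := by
  intro s c B hB y
  have := h₁ s (fun k => m₂ k * c k) (A₂ * B) (h₂ s c B hB) y
  simpa only [mul_assoc] using this

lemma MultBound.mono {m : Z3 → ℂ} {A A' : ℝ} (h : MultBound m A) (hA : A ≤ A') :
    MultBound m A' := by
  intro s c B hB y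
  have hB0 : 0 ≤ B := (norm_nonneg _).trans (hB 0)
  exact (h s c B hB y).trans (mul_le_mul_of_nonneg_right hA hB0)

/-- A multiplier given by an integrable kernel. -/
lemma multBound_of_kernel {Y : Type*} [MeasurableSpace Y] {μ : Measure Y} {γ : Y → Fin 3 → ℝ}
    {K : Y → ℂ} {m : Z3 → ℂ} {A : ℝ} (hγ : Measurable γ) (hK : Integrable K μ)
    (hm : ∀ k, m k = ∫ y, K y * trigMode k (-γ y) ∂μ) (hA : ∫ y, ‖K y‖ ∂μ ≤ A) :
    MultBound m A := by
  have hint : ∀ k, Integrable (fun y => K y * trigMode k (-γ y)) μ := fun k => by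
    refine hK.mul_bdd (c := 1) ?_ (ae_of_all _ fun y => (norm_trigMode _ _).le)
    exact ((continuous_trigMode k).measurable.comp hγ.neg).aestronglyMeasurable
  intro s c B hB x
  have hB0 : 0 ≤ B := (norm_nonneg _).trans (hB 0)
  have key : ∑ k ∈ s, m k * c k * trigMode k x
      = ∫ y, K y * ∑ k ∈ s, c k * trigMode k (x - γ y) ∂μ := by
    have h1 : ∀ y, K y * ∑ k ∈ s, c k * trigMode k (x - γ y)
        = ∑ k ∈ s, (K y * trigMode k (-γ y)) * (c k * trigMode k x) := fun y => by
      rw [Finset.mul_sum]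
      refine Finset.sum_congr rfl fun k _ => ?_
      rw [sub_eq_add_neg, trigMode_add]
      ring
    simp_rw [h1]
    rw [integral_finsetSum _ fun k _ => (hint k).mul_const _]
    refine Finset.sum_congr rfl fun k _ => ?_
    rw [integral_mul_const, hm k]
    ring
  rw [key]
  calc _ ≤ ∫ y, ‖K y‖ * B ∂μ := by
        refine norm_integral_le_of_norm_le (hK.norm.mul_const B) (ae_of_all _ fun y => ?_)
        rw [norm_mul]
        exact mul_le_mul_of_nonneg_left (hB _) (norm_nonneg _)
    _ ≤ A * B := by
        rw [integral_mul_const]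
        exact mul_le_mul_of_nonneg_right hA hB0

lemma integrableOn_box {f : (Fin 3 → ℝ) → ℂ} (hf : Continuous f) (c : ℝ) :
    IntegrableOn f (box c) := hf.continuousOn.integrableOn_compact (isCompact_box c)

lemma integrableOn_box_real {f : (Fin 3 → ℝ) → ℝ} (hf : Continuous f) (c : ℝ) :
    IntegrableOn f (box c) := hf.continuousOn.integrableOn_compact (isCompact_box c)

lemma integral_trigSum_mul (s : Finset Z3) (σ : Z3 → ℂ) (l : Z3) (c : ℝ) :
    ∫ y in box c, (∑ k ∈ s, σ k * trigMode k y) * trigMode (-l) y =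
      if l ∈ s then (((2 * Real.pi) ^ 3 : ℝ) : ℂ) * σ l else 0 := by
  have h1 : ∀ y, (∑ k ∈ s, σ k * trigMode k y) * trigMode (-l) y
      = ∑ k ∈ s, σ k * trigMode (k + -l) y := fun y => by
    rw [Finset.sum_mul]
    refine Finset.sum_congr rfl fun k _ => ?_
    rw [trigMode_add_index, mul_assoc]
  simp_rw [h1]
  rw [integral_finsetSum _ fun k _ => (integrableOn_box (by fun_prop) c)]
  simp_rw [integral_const_mul, integral_trigMode, add_neg_eq_zero, mul_ite, mul_zero]
  rw [Finset.sum_ite_eq' s l, mul_comm]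

/-- Parseval's identity for trigonometric polynomials. -/
lemma integral_norm_sq_trigSum (s : Finset Z3) (σ : Z3 → ℂ) (c : ℝ) :
    ∫ y in box c, ‖∑ k ∈ s, σ k * trigMode k y‖ ^ 2 = (2 * Real.pi) ^ 3 * ∑ k ∈ s, ‖σ k‖ ^ 2 := by
  have h1 : ∀ y, ((‖∑ k ∈ s, σ k * trigMode k y‖ ^ 2 : ℝ) : ℂ)
      = ∑ l ∈ s, (starRingEnd ℂ) (σ l) * ((∑ k ∈ s, σ k * trigMode k y) * trigMode (-l) y) :=
    fun y => by
      rw [Complex.ofReal_pow, ← Complex.mul_conj', map_sum, Finset.mul_sum]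
      refine Finset.sum_congr rfl fun l _ => ?_
      rw [map_mul, conj_trigMode]
      ring
  rw [← Complex.ofReal_inj, ← integral_complex_ofReal]
  simp_rw [h1]
  rw [integral_finsetSum _ fun k _ => (integrableOn_box (by fun_prop) c)]
  simp_rw [integral_const_mul, integral_trigSum_mul]
  push_cast
  rw [Finset.mul_sum]
  refine Finset.sum_congr rfl fun l hl => ?_
  rw [if_pos hl, ← Complex.mul_conj']
  ring

/-- The multiplier is convolution with the trigonometric polynomial whose coefficients are `σ`, so
its norm is at most the normalised `L¹` norm of that kernel. The corner `c` is left free so that the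
period box can be centred at the origin, where the kernel concentrates. -/
lemma multBound_of_trigSum (s : Finset Z3) (σ : Z3 → ℂ) (hσ : ∀ k ∉ s, σ k = 0) (c A : ℝ)
    (hA : ∫ y in box c, ‖∑ k ∈ s, σ k * trigMode k y‖ ≤ (2 * Real.pi) ^ 3 * A) :
    MultBound σ A := by
  have hpi : (0 : ℝ) < (2 * Real.pi) ^ 3 := by positivity
  refine multBound_of_kernel (μ := volume.restrict (box c)) (γ := fun y => y)
    (K := fun y => ((((2 * Real.pi) ^ 3 : ℝ) : ℂ))⁻¹ * ∑ k ∈ s, σ k * trigMode k y)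
    measurable_id (integrableOn_box (by fun_prop) c) (fun k => ?_) ?_
  · simp_rw [mul_assoc, integral_const_mul, ← trigMode_neg_index, integral_trigSum_mul]
    split_ifs with h
    · rw [inv_mul_cancel_left₀]
      exact_mod_cast hpi.ne'
    · rw [hσ k h, mul_zero]
  · simp_rw [norm_mul, norm_inv, Complex.norm_real, Real.norm_of_nonneg hpi.le]
    rw [integral_const_mul, inv_mul_le_iff₀ hpi]
    exact hA

/-- Each Fourier coefficient of a trigonometric polynomial is bounded by its supremum. No regularity
of `σ` is needed, which suits the low-frequency block, where the symbol need not be smooth at the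
origin. -/
lemma multBound_sum_norm (s : Finset Z3) (σ : Z3 → ℂ) (hσ : ∀ k ∉ s, σ k = 0) :
    MultBound σ (∑ k ∈ s, ‖σ k‖) := by
  intro s' c B hB y
  have hB0 : 0 ≤ B := (norm_nonneg _).trans (hB 0)
  have hc : ∀ l ∈ s', ‖c l‖ ≤ B := fun l hl => by
    have hpi : (0 : ℝ) < (2 * Real.pi) ^ 3 := by positivity
    have h1 := integral_trigSum_mul s' c l 0
    rw [if_pos hl] at h1
    have h2 : ‖∫ y in box 0, (∑ k ∈ s', c k * trigMode k y) * trigMode (-l) y‖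
        ≤ B * volume.real (box 0) := by
      refine norm_setIntegral_le_of_norm_le_const (isCompact_box 0).measure_lt_top fun y _ => ?_
      rw [norm_mul, norm_trigMode, mul_one]
      exact hB y
    have h3 : volume.real (box 0) = (2 * Real.pi) ^ 3 := by
      rw [box, Measure.real, volume_pi, Measure.pi_pi]
      simp [Real.pi_pos.le]
    rw [h1, h3, norm_mul, Complex.norm_real, Real.norm_of_nonneg hpi.le, mul_comm] at h2
    exact le_of_mul_le_mul_right h2 hpi
  calc ‖∑ k ∈ s', σ k * c k * trigMode k y‖ ≤ ∑ k ∈ s', ‖σ k‖ * B := by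
        refine norm_sum_le_of_le _ fun k hk => ?_
        rw [norm_mul, norm_mul, norm_trigMode, mul_one]
        exact mul_le_mul_of_nonneg_left (hc k hk) (norm_nonneg _)
    _ ≤ ∑ k ∈ s, ‖σ k‖ * B := by
        rw [← Finset.sum_filter_of_ne (p := fun k => k ∈ s)]
        · refine Finset.sum_le_sum_of_subset_of_nonneg ?_ fun k _ _ => by positivity
          intro k hk
          exact (Finset.mem_filter.1 hk).2
        · intro k _ hk
          by_contra hks
          exact hk (by simp [hσ k hks])
    _ = _ := by rw [Finset.sum_mul]

/-! ### Kernel bounds from second differences of the symbol -/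

/-- The lattice points of the cube `[-R, R]³`. -/
def latticeBox (R : ℕ) : Finset Z3 := Fintype.piFinset fun _ => Finset.Icc (-(R : ℤ)) R

lemma mem_latticeBox {R : ℕ} {k : Z3} : k ∈ latticeBox R ↔ ∀ a, |k a| ≤ R := by
  simp [latticeBox, Fintype.mem_piFinset, abs_le]

lemma card_latticeBox (R : ℕ) : ((latticeBox R).card : ℝ) = (2 * R + 1) ^ 3 := by
  have h : (R + 1 + R : ℤ).toNat = 2 * R + 1 := by omega
  simp [latticeBox, Fintype.card_piFinset, h]

/-- Summation by parts: shifting the coefficients multiplies the kernel by a mode. Both vanishing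
hypotheses are there so that the sums over `S` equal the sums over the whole lattice, where the
shift is a bijection. -/
lemma sum_shift {S : Finset Z3} {σ : Z3 → ℂ} (v : Z3) (h₀ : ∀ k ∉ S, σ k = 0)
    (h₁ : ∀ k ∉ S, σ (k + v) = 0) (y : Fin 3 → ℝ) :
    ∑ k ∈ S, σ (k + v) * trigMode k y = trigMode (-v) y * ∑ k ∈ S, σ k * trigMode k y := by
  have e₀ : ∑ k ∈ S, σ (k + v) * trigMode k y = ∑ᶠ k, σ (k + v) * trigMode k y :=
    (finsum_eq_sum_of_support_subset _ fun k hk => by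
      by_contra hkS
      exact hk (by simp [h₁ k hkS])).symm
  have e₁ : ∑ k ∈ S, σ k * trigMode (k - v) y = ∑ᶠ k, σ k * trigMode (k - v) y :=
    (finsum_eq_sum_of_support_subset _ fun k hk => by
      by_contra hkS
      exact hk (by simp [h₀ k hkS])).symm
  have e₂ : ∑ᶠ k, σ (k + v) * trigMode k y = ∑ᶠ k, σ k * trigMode (k - v) y := by
    rw [← finsum_comp_equiv (Equiv.addRight v) (f := fun k => σ k * trigMode (k - v) y)]
    simp
  rw [e₀, e₂, ← e₁, Finset.mul_sum]
  refine Finset.sum_congr rfl fun k _ => ?_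
  rw [sub_eq_add_neg, trigMode_add_index]
  ring

/-- This is the factor by which the kernel is multiplied when its coefficients are replaced by their
second differences in direction `a`. -/
lemma trigMode_single_add_neg (a : Fin 3) (y : Fin 3 → ℝ) :
    trigMode (-Pi.single a 1) y + trigMode (- -Pi.single a 1) y - 2
      = ((-(2 - 2 * Real.cos (y a)) : ℝ) : ℂ) := by
  have h : ∀ n : ℤ, ∑ b, (((Pi.single a n : Z3) b : ℤ) : ℝ) * y b = n * y a := fun n => by
    rw [Finset.sum_eq_single a] <;> simp +contextual
  rw [← Pi.single_neg, ← Pi.single_neg, trigMode, trigMode, h, h]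
  have := Complex.two_cos (y a : ℂ)
  push_cast
  rw [show Complex.I * (-1 * (y a : ℂ)) = -(y a : ℂ) * Complex.I by ring,
    show Complex.I * (1 * (y a : ℂ)) = (y a : ℂ) * Complex.I by ring]
  linear_combination -this

/-- The weight used to bound the `L¹` norm of a kernel by weighted `L²` norms. -/
def kernelWeight (N : ℝ) (y : Fin 3 → ℝ) : ℝ := 1 + N ^ 4 * ∑ a, (2 - 2 * Real.cos (y a)) ^ 2

lemma one_le_kernelWeight (N : ℝ) (y : Fin 3 → ℝ) : 1 ≤ kernelWeight N y := by
  unfold kernelWeight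
  have : 0 ≤ N ^ 4 * ∑ a, (2 - 2 * Real.cos (y a)) ^ 2 := by positivity
  linarith

/-- On `[-π, π]` one has `1 - cos y ≥ 2y²/π²`. The norm on `Fin 3 → ℝ` is the maximum norm, so the
largest coordinate alone gives the bound. -/
lemma kernelWeight_lower (N : ℝ) {y : Fin 3 → ℝ} (hy : y ∈ box (-Real.pi)) :
    (1 + ‖N • y‖ ^ 2) ^ 2 ≤ Real.pi ^ 4 / 8 * kernelWeight N y := by
  obtain ⟨a, ha⟩ := Finite.exists_max fun a => ‖y a‖
  have hn : ‖y‖ = ‖y a‖ :=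
    le_antisymm ((pi_norm_le_iff_of_nonneg (norm_nonneg _)).2 ha) (norm_le_pi_norm y a)
  have hya := hy a (Set.mem_univ a)
  have hab : |y a| ≤ Real.pi := abs_le.2 ⟨hya.1, by linarith [hya.2]⟩
  have hcos := Real.cos_le_one_sub_mul_cos_sq hab
  have hpi : 2 ≤ Real.pi := Real.two_le_pi
  have hv : 4 / Real.pi ^ 2 * (y a) ^ 2 ≤ 2 - 2 * Real.cos (y a) := by
    have : 4 / Real.pi ^ 2 * (y a) ^ 2 = 2 * (2 / Real.pi ^ 2 * (y a) ^ 2) := by ring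
    linarith
  have hv2 : 16 / Real.pi ^ 4 * (y a) ^ 4 ≤ (2 - 2 * Real.cos (y a)) ^ 2 := by
    have h := pow_le_pow_left₀ (by positivity) hv 2
    refine le_trans (le_of_eq ?_) h
    field_simp
    ring
  have hsum : (2 - 2 * Real.cos (y a)) ^ 2 ≤ ∑ a, (2 - 2 * Real.cos (y a)) ^ 2 :=
    Finset.single_le_sum (f := fun a => (2 - 2 * Real.cos (y a)) ^ 2)
      (fun _ _ => sq_nonneg _) (Finset.mem_univ a)
  have h1 : ‖N • y‖ ^ 2 = N ^ 2 * (y a) ^ 2 := by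
    rw [norm_smul, hn, mul_pow, Real.norm_eq_abs, Real.norm_eq_abs, sq_abs, sq_abs]
  rw [h1]
  have hp : 16 ≤ Real.pi ^ 4 := by
    have := pow_le_pow_left₀ (by norm_num) hpi 4
    linarith
  have h2 : N ^ 4 * (16 / Real.pi ^ 4 * (y a) ^ 4) ≤ N ^ 4 * ∑ a, (2 - 2 * Real.cos (y a)) ^ 2 :=
    mul_le_mul_of_nonneg_left (hv2.trans hsum) (by positivity)
  calc (1 + N ^ 2 * y a ^ 2) ^ 2 ≤ 2 * (1 + N ^ 4 * y a ^ 4) := by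
        nlinarith [sq_nonneg (1 - N ^ 2 * y a ^ 2)]
    _ ≤ Real.pi ^ 4 / 8 + 2 * (N ^ 4 * y a ^ 4) := by linarith
    _ = Real.pi ^ 4 / 8 * (1 + N ^ 4 * (16 / Real.pi ^ 4 * (y a) ^ 4)) := by
        field_simp
        ring
    _ ≤ Real.pi ^ 4 / 8 * kernelWeight N y := by
        unfold kernelWeight
        gcongr

@[fun_prop]
lemma continuous_kernelWeight (N : ℝ) : Continuous (kernelWeight N) := by
  unfold kernelWeight
  fun_prop

/-- The inverse weight is dominated by a multiple of `(1 + |Ny|²)⁻²`, which is integrable in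
dimension three because its decay exponent `4` exceeds `3`. Rescaling produces `N⁻³`. -/
lemma integral_inv_kernelWeight_le :
    ∃ C : ℝ, 0 ≤ C ∧ ∀ N : ℝ, 1 ≤ N →
      ∫ y in box (-Real.pi), (kernelWeight N y)⁻¹ ≤ C / N ^ 3 := by
  set J : (Fin 3 → ℝ) → ℝ := fun y => ((1 : ℝ) + ‖y‖ ^ 2) ^ (-(4 : ℝ) / 2) with hJ
  have hJi : Integrable J := integrable_rpow_neg_one_add_norm_sq (by simp; norm_num)
  have hJ0 : ∀ y, 0 ≤ J y := fun y => by positivity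
  refine ⟨Real.pi ^ 4 / 8 * ∫ y, J y, mul_nonneg (by positivity) (integral_nonneg hJ0),
    fun N hN => ?_⟩
  have hN0 : 0 < N := by linarith
  have hJN : Integrable fun y => J (N • y) := hJi.comp_smul hN0.ne'
  have hJv : ∀ y, J y = ((1 + ‖y‖ ^ 2) ^ 2)⁻¹ := fun y => by
    rw [hJ]
    norm_num
  calc ∫ y in box (-Real.pi), (kernelWeight N y)⁻¹
      ≤ ∫ y in box (-Real.pi), Real.pi ^ 4 / 8 * J (N • y) := by
        refine setIntegral_mono_on ?_ (hJN.const_mul _).integrableOn (measurableSet_box _)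
          fun y hy => ?_
        · exact integrableOn_box_real ((continuous_kernelWeight N).inv₀ fun y =>
            (zero_lt_one.trans_le (one_le_kernelWeight N y)).ne') _
        · have h := kernelWeight_lower N hy
          have hw := zero_lt_one.trans_le (one_le_kernelWeight N y)
          rw [hJv, ← div_eq_mul_inv, inv_eq_one_div, div_le_div_iff₀ hw (by positivity), one_mul]
          exact h
    _ ≤ ∫ y, Real.pi ^ 4 / 8 * J (N • y) :=
        setIntegral_le_integral (hJN.const_mul _)
          (ae_of_all _ fun y => mul_nonneg (by positivity) (hJ0 _))
    _ = Real.pi ^ 4 / 8 * (∫ y, J y) / N ^ 3 := by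
        rw [integral_const_mul, Measure.integral_comp_smul]
        simp only [Module.finrank_fintype_fun_eq_card, Fintype.card_fin, smul_eq_mul]
        rw [abs_of_nonneg (by positivity)]
        ring

/-- A multiplier supported in a cube of side `N`, bounded by `A`, and with second differences
bounded by `A / N²`, is bounded by a multiple of `A`. -/
lemma multBound_of_second_difference (b : ℝ) (hb : 0 ≤ b) :
    ∃ C : ℝ, 0 < C ∧ ∀ (N A : ℝ) (σ : Z3 → ℂ), 1 ≤ N → 0 < A →
      (∀ k, σ k ≠ 0 → ∀ a, |(k a : ℝ)| ≤ b * N) → (∀ k, ‖σ k‖ ≤ A) →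
      (∀ k a, ‖σ (k + Pi.single a 1) + σ (k + -Pi.single a 1) - 2 * σ k‖ ≤ A / N ^ 2) →
      MultBound σ (C * A) := by
  obtain ⟨C₀, hC₀, hW⟩ := integral_inv_kernelWeight_le
  refine ⟨(C₀ / (2 * Real.pi) ^ 3 + 4 * (2 * b + 5) ^ 3) / 2, by positivity,
    fun N A σ hN hA hsupp hσ hd => ?_⟩
  have hN0 : 0 < N := by linarith
  -- The extra unit leaves room for shifts by a basis vector: outside `S` the shifted coefficients
  -- vanish too.
  set R : ℕ := ⌈b * N⌉₊ + 1 with hR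
  set S := latticeBox R with hS
  have hcard : (S.card : ℝ) ≤ (2 * b + 5) ^ 3 * N ^ 3 := by
    rw [hS, card_latticeBox, ← mul_pow]
    have h1 : (R : ℝ) ≤ b * N + 2 := by
      have := Nat.ceil_lt_add_one (a := b * N) (by positivity)
      rw [hR]; push_cast; linarith
    refine pow_le_pow_left₀ (by positivity) ?_ 3
    nlinarith
  have hout : ∀ k ∉ S, ∀ v : Z3, (∀ a, |v a| ≤ 1) → σ (k + v) = 0 := by
    intro k hk v hv
    by_contra h
    refine hk (mem_latticeBox.2 fun a => ?_)
    have h1 := hsupp _ h a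
    have h2 : |(k + v) a| ≤ (⌈b * N⌉₊ : ℤ) := by
      have : |(((k + v) a : ℤ) : ℝ)| ≤ ((⌈b * N⌉₊ : ℤ) : ℝ) := h1.trans (by
        push_cast; exact Nat.le_ceil _)
      exact_mod_cast this
    have h3 := hv a
    rw [hR]
    rw [Pi.add_apply] at h2
    push_cast
    rw [abs_le] at *
    omega
  have hout0 : ∀ k ∉ S, σ k = 0 := fun k hk => by simpa using hout k hk 0 (by simp)
  have hsingle : ∀ (n : ℤ), |n| ≤ 1 → ∀ a b : Fin 3, |(Pi.single a n : Z3) b| ≤ 1 := by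
    intro n hn a b
    rw [Pi.single_apply]
    split_ifs <;> simp [hn]
  set d : Fin 3 → Z3 → ℂ := fun a k =>
    σ (k + Pi.single a 1) + σ (k + -Pi.single a 1) - 2 * σ k with hdd
  set K : (Fin 3 → ℝ) → ℂ := fun y => ∑ k ∈ S, σ k * trigMode k y with hK
  have hKc : Continuous K := by fun_prop
  have hdK : ∀ a y, ∑ k ∈ S, d a k * trigMode k y
      = ((-(2 - 2 * Real.cos (y a)) : ℝ) : ℂ) * K y := by
    intro a y
    have e₁ := sum_shift (Pi.single a 1) hout0 (fun k hk => hout k hk _ (hsingle 1 (by simp) a)) y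
    have e₂ := sum_shift (-Pi.single a 1) hout0 (fun k hk => hout k hk _ (by
      rw [← Pi.single_neg]; exact hsingle (-1) (by simp) a)) y
    rw [← trigMode_single_add_neg, sub_mul, add_mul, hK, ← e₁, ← e₂, Finset.mul_sum,
      ← Finset.sum_add_distrib, ← Finset.sum_sub_distrib]
    refine Finset.sum_congr rfl fun k _ => ?_
    rw [hdd]
    ring
  -- Parseval for the kernel and for its three second differences. Each of the four terms is at most
  -- the same quantity, since `N⁴ (A/N²)² = A²`; hence the factor `4`.
  have hwK : ∫ y in box (-Real.pi), kernelWeight N y * ‖K y‖ ^ 2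
      ≤ (2 * Real.pi) ^ 3 * (4 * (2 * b + 5) ^ 3 * N ^ 3 * A ^ 2) := by
    have h1 : ∀ y, kernelWeight N y * ‖K y‖ ^ 2
        = ‖K y‖ ^ 2 + ∑ a, N ^ 4 * ‖∑ k ∈ S, d a k * trigMode k y‖ ^ 2 := fun y => by
      simp_rw [hdK, norm_mul, Complex.norm_real, Real.norm_eq_abs, mul_pow, sq_abs, neg_sq]
      rw [kernelWeight, add_mul, one_mul, mul_assoc, Finset.sum_mul, Finset.mul_sum]
    simp_rw [h1]
    rw [integral_add (integrableOn_box_real (by fun_prop) _)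
      (integrableOn_box_real (by fun_prop) _),
      integral_finsetSum _ fun a _ => (integrableOn_box_real (by fun_prop) _)]
    simp_rw [integral_const_mul, hK, integral_norm_sq_trigSum]
    have hs0 : ∑ k ∈ S, ‖σ k‖ ^ 2 ≤ (2 * b + 5) ^ 3 * N ^ 3 * A ^ 2 := by
      calc ∑ k ∈ S, ‖σ k‖ ^ 2 ≤ ∑ k ∈ S, A ^ 2 :=
            Finset.sum_le_sum fun k _ => pow_le_pow_left₀ (norm_nonneg _) (hσ k) 2
        _ = S.card * A ^ 2 := by simp
        _ ≤ _ := by gcongr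
    have hs : ∀ a, ∑ k ∈ S, ‖d a k‖ ^ 2 ≤ (2 * b + 5) ^ 3 * N ^ 3 * (A / N ^ 2) ^ 2 := fun a => by
      calc ∑ k ∈ S, ‖d a k‖ ^ 2 ≤ ∑ k ∈ S, (A / N ^ 2) ^ 2 :=
            Finset.sum_le_sum fun k _ => pow_le_pow_left₀ (norm_nonneg _) (hd k a) 2
        _ = S.card * (A / N ^ 2) ^ 2 := by simp
        _ ≤ _ := by gcongr
    calc _ ≤ (2 * Real.pi) ^ 3 * ((2 * b + 5) ^ 3 * N ^ 3 * A ^ 2) + ∑ a : Fin 3,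
          N ^ 4 * ((2 * Real.pi) ^ 3 * ((2 * b + 5) ^ 3 * N ^ 3 * (A / N ^ 2) ^ 2)) := by
          gcongr with a
          exact hs a
      _ = _ := by
          simp only [Finset.sum_const, Finset.card_univ, Fintype.card_fin, nsmul_eq_mul]
          field_simp
          norm_num
  refine multBound_of_trigSum S σ hout0 (-Real.pi) _ ?_
  -- In place of Cauchy–Schwarz, the pointwise inequality `|K| ≤ (q/2) w⁻¹ + (2q)⁻¹ w |K|²` is
  -- integrated. With `∫ w⁻¹` of order `N⁻³` and `∫ w |K|²` of order `N³ A²`, this `q` makes both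
  -- terms of order `A`.
  set q : ℝ := A * N ^ 3 with hq
  have hq0 : 0 < q := by positivity
  have hwc : Continuous fun y => (kernelWeight N y)⁻¹ := (continuous_kernelWeight N).inv₀ fun y =>
    (zero_lt_one.trans_le (one_le_kernelWeight N y)).ne'
  have hpt : ∀ y, ‖K y‖ ≤ q / 2 * (kernelWeight N y)⁻¹
      + (2 * q)⁻¹ * (kernelWeight N y * ‖K y‖ ^ 2) := fun y => by
    have hw := zero_lt_one.trans_le (one_le_kernelWeight N y)
    have h : q / 2 * (kernelWeight N y)⁻¹ + (2 * q)⁻¹ * (kernelWeight N y * ‖K y‖ ^ 2) - ‖K y‖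
        = (q - kernelWeight N y * ‖K y‖) ^ 2 / (2 * q * kernelWeight N y) := by
      field_simp
      ring
    have : 0 ≤ (q - kernelWeight N y * ‖K y‖) ^ 2 / (2 * q * kernelWeight N y) := by positivity
    linarith
  calc ∫ y in box (-Real.pi), ‖K y‖
      ≤ ∫ y in box (-Real.pi), (q / 2 * (kernelWeight N y)⁻¹
          + (2 * q)⁻¹ * (kernelWeight N y * ‖K y‖ ^ 2)) :=
        setIntegral_mono (integrableOn_box_real (by fun_prop) _)
          (integrableOn_box_real (by fun_prop) _) hpt
    _ = q / 2 * (∫ y in box (-Real.pi), (kernelWeight N y)⁻¹)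
          + (2 * q)⁻¹ * ∫ y in box (-Real.pi), kernelWeight N y * ‖K y‖ ^ 2 := by
        rw [integral_add (integrableOn_box_real (by fun_prop) _)
          (integrableOn_box_real (by fun_prop) _), integral_const_mul, integral_const_mul]
    _ ≤ q / 2 * (C₀ / N ^ 3)
          + (2 * q)⁻¹ * ((2 * Real.pi) ^ 3 * (4 * (2 * b + 5) ^ 3 * N ^ 3 * A ^ 2)) := by
        gcongr
        exact hW N hN
    _ = (2 * Real.pi) ^ 3 * ((C₀ / (2 * Real.pi) ^ 3 + 4 * (2 * b + 5) ^ 3) / 2 * A) := by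
        have := Real.pi_pos
        rw [hq]
        field_simp

/-! ### Sharp cutoffs and the Dirichlet kernel -/

/-- The Dirichlet kernel `∑_{|l| ≤ M} exp(i l y)`. -/
def dirichletKernel (M : ℕ) (y : ℝ) : ℂ :=
  ∑ j ∈ Finset.range (2 * M + 1), Complex.exp (Complex.I * ((((j : ℤ) - M : ℤ) : ℝ) * y : ℝ))

@[fun_prop]
lemma continuous_dirichletKernel (M : ℕ) : Continuous (dirichletKernel M) := by
  unfold dirichletKernel
  fun_prop

lemma norm_exp_I_mul_ofReal (x : ℝ) : ‖Complex.exp (Complex.I * x)‖ = 1 := by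
  rw [mul_comm, Complex.norm_exp_ofReal_mul_I]

lemma norm_dirichletKernel_le (M : ℕ) (y : ℝ) : ‖dirichletKernel M y‖ ≤ 2 * M + 1 := by
  refine (norm_sum_le _ _).trans ?_
  simp_rw [norm_exp_I_mul_ofReal]
  simp

/-- A geometric sum has numerator at most `2` in modulus, while `|e^{iy} - 1| = 2 |sin (y/2)| ≥
2|y|/π` on `[-π, π]`. -/
lemma norm_dirichletKernel_le_inv (M : ℕ) {y : ℝ} (hy : |y| ≤ Real.pi) (hy0 : y ≠ 0) :
    ‖dirichletKernel M y‖ ≤ Real.pi / |y| := by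
  have h1 : dirichletKernel M y = Complex.exp (Complex.I * ((-M * y : ℝ) : ℂ)) *
      ∑ j ∈ Finset.range (2 * M + 1), Complex.exp (Complex.I * y) ^ j := by
    rw [dirichletKernel, Finset.mul_sum]
    refine Finset.sum_congr rfl fun j _ => ?_
    rw [← Complex.exp_nat_mul, ← Complex.exp_add]
    congr 1
    push_cast
    ring
  have h2 : ‖dirichletKernel M y‖ * ‖Complex.exp (Complex.I * y) - 1‖ ≤ 2 := by
    rw [h1, norm_mul, norm_exp_I_mul_ofReal, one_mul, ← norm_mul, geom_sum_mul]
    refine (norm_sub_le _ _).trans ?_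
    rw [norm_pow, norm_exp_I_mul_ofReal, one_pow, norm_one]
    norm_num
  have h3 : 2 / Real.pi * |y| ≤ ‖Complex.exp (Complex.I * y) - 1‖ := by
    rw [Complex.norm_exp_I_mul_ofReal_sub_one, norm_mul, Real.norm_ofNat, Real.norm_eq_abs]
    have := Real.mul_abs_le_abs_sin (x := y / 2) (by rw [abs_div, abs_two]; linarith)
    rw [abs_div, abs_two] at this
    linarith
  have hpos : 0 < |y| := abs_pos.2 hy0
  rw [le_div_iff₀ hpos]
  have h4 := (mul_le_mul_of_nonneg_left h3 (norm_nonneg (dirichletKernel M y))).trans h2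
  have hpi := Real.pi_pos
  have h5 : ‖dirichletKernel M y‖ * (2 / Real.pi * |y|)
      = 2 / Real.pi * (‖dirichletKernel M y‖ * |y|) := by ring
  rw [h5, div_mul_eq_mul_div, div_le_iff₀ hpi] at h4
  linarith

/-- The sharp cutoff in one coordinate costs an arbitrarily small power. -/
lemma multBound_coordinate_cutoff (η : ℝ) (hη : 0 < η) :
    ∃ C : ℝ, 0 < C ∧ ∀ (a : Fin 3) (M : ℕ),
      MultBound (fun k => if |k a| ≤ M then 1 else 0) (C * (2 * M + 1) ^ η) := by
  -- Since `2M + 1 ≥ 1`, the bound for exponent `1` implies it for every larger one.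
  wlog hη1 : η ≤ 1 generalizing η
  · obtain ⟨C, hC, h⟩ := this 1 one_pos le_rfl
    refine ⟨C, hC, fun a M => (h a M).mono ?_⟩
    gcongr
    · linarith [(Nat.cast_nonneg M : (0 : ℝ) ≤ M)]
    · linarith
  set I : Set ℝ := Icc (-Real.pi) (-Real.pi + 2 * Real.pi) with hI
  -- Interpolating the bounds `2M + 1` and `π/|y|` with exponents `η` and `1 - η` leaves the
  -- singularity `|y|^{η-1}`, which is integrable at the origin.
  set J : ℝ → ℝ := fun y => (Real.pi / |y|) ^ (1 - η) with hJ
  have hJ0 : ∀ y, 0 ≤ J y := fun y => by positivity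
  have hJi : IntegrableOn J I := by
    have h1 : IntervalIntegrable (fun y : ℝ => |y| ^ (η - 1)) volume (-Real.pi) Real.pi := by
      refine intervalIntegrable_of_even (fun x => by simp) fun x hx => ?_
      refine (intervalIntegral.intervalIntegrable_rpow' (a := 0) (b := x)
        (show -1 < η - 1 by linarith)).congr fun y hy => ?_
      rw [uIoc_of_le hx.le] at hy
      rw [abs_of_pos hy.1]
    rw [intervalIntegrable_iff_integrableOn_Icc_of_le (by linarith [Real.pi_pos])] at h1
    have h2 : -Real.pi + 2 * Real.pi = Real.pi := by ring
    rw [hI, h2]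
    refine (h1.const_mul (Real.pi ^ (1 - η))).congr (ae_of_all _ fun y => ?_)
    simp only [hJ]
    rw [Real.div_rpow Real.pi_pos.le (abs_nonneg y), div_eq_mul_inv, ← Real.rpow_neg (abs_nonneg y)]
    congr 2
    ring
  refine ⟨1 + (2 * Real.pi)⁻¹ * ∫ y in I, J y, ?_, fun a M => ?_⟩
  · have : 0 ≤ ∫ y in I, J y := integral_nonneg hJ0
    have := Real.pi_pos
    positivity
  have hK : IntegrableOn (fun y => ((2 * Real.pi : ℝ) : ℂ)⁻¹ * dirichletKernel M y) I :=
    (by fun_prop : Continuous fun y =>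
      ((2 * Real.pi : ℝ) : ℂ)⁻¹ * dirichletKernel M y).continuousOn.integrableOn_compact isCompact_Icc
  -- The kernel is a measure carried by the `a`-th coordinate axis, so the convolution is a
  -- one-dimensional integral.
  refine multBound_of_kernel (μ := volume.restrict I) (γ := fun y => Pi.single a y)
    (measurable_pi_iff.2 fun b => ?_) hK (fun k => ?_) ?_
  · by_cases h : b = a
    · subst h
      simp only [Pi.single_eq_same]
      exact measurable_id
    · simp [Pi.single_eq_of_ne h]
  · have h1 : ∀ y : ℝ, ((2 * Real.pi : ℝ) : ℂ)⁻¹ * dirichletKernel M y *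
          trigMode k (-Pi.single a y) = ((2 * Real.pi : ℝ) : ℂ)⁻¹ *
          ∑ j ∈ Finset.range (2 * M + 1),
            Complex.exp (Complex.I * ((((j : ℤ) - M - k a : ℤ) : ℝ) * y : ℝ)) := fun y => by
      have h : ∑ b, (k b : ℝ) * (-Pi.single a y : Fin 3 → ℝ) b = -(k a) * y := by
        rw [Finset.sum_eq_single a] <;> simp +contextual
      rw [dirichletKernel, mul_assoc, Finset.sum_mul, trigMode, h]
      congr 1
      refine Finset.sum_congr rfl fun j _ => ?_
      rw [← Complex.exp_add]
      congr 1
      push_cast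
      ring
    rw [integral_congr_ae (ae_of_all _ h1), integral_const_mul,
      integral_finsetSum _ fun j _ => Continuous.integrableOn_Icc (by fun_prop)]
    simp_rw [integral_exp_int_mul]
    have hpi : ((2 * Real.pi : ℝ) : ℂ) ≠ 0 := by exact_mod_cast (by positivity)
    split_ifs with h
    · rw [abs_le] at h
      -- The summation index runs from `0` to `2M`, so the frequency `k a` sits at position `k a +
      -- M`.
      rw [Finset.sum_eq_single (k a + M).toNat]
      · rw [if_pos (by omega), inv_mul_cancel₀ hpi]
      · intro j _ hj
        rw [if_neg (by omega)]
      · intro hj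
        rw [Finset.mem_range] at hj
        omega
    · rw [abs_le] at h
      rw [Finset.sum_eq_zero, mul_zero]
      intro j hj
      rw [Finset.mem_range] at hj
      rw [if_neg (by omega)]
  · have hpt : ∀ y ∈ I, y ≠ 0 → ‖((2 * Real.pi : ℝ) : ℂ)⁻¹ * dirichletKernel M y‖
        ≤ (2 * Real.pi)⁻¹ * ((2 * M + 1) ^ η * J y) := fun y hy hy0 => by
      have hpi : (0 : ℝ) < 2 * Real.pi := by positivity
      have hyp : |y| ≤ Real.pi := abs_le.2 ⟨hy.1, by linarith [hy.2]⟩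
      rw [norm_mul, norm_inv, Complex.norm_real, Real.norm_of_nonneg hpi.le]
      gcongr
      rcases eq_or_lt_of_le (norm_nonneg (dirichletKernel M y)) with h0 | h0
      · rw [← h0]
        exact mul_nonneg (by positivity) (hJ0 y)
      calc ‖dirichletKernel M y‖ = ‖dirichletKernel M y‖ ^ η * ‖dirichletKernel M y‖ ^ (1 - η) := by
            rw [← Real.rpow_add h0]; simp
        _ ≤ (2 * M + 1) ^ η * J y := by
            refine mul_le_mul ?_ ?_ (by positivity) (by positivity)
            · exact Real.rpow_le_rpow h0.le (norm_dirichletKernel_le M y) hη.le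
            · exact Real.rpow_le_rpow h0.le (norm_dirichletKernel_le_inv M hyp hy0) (by linarith)
    calc _ ≤ ∫ y in I, (2 * Real.pi)⁻¹ * ((2 * M + 1) ^ η * J y) := by
          refine setIntegral_mono_on_ae hK.norm ((hJi.const_mul _).const_mul _) measurableSet_Icc ?_
          filter_upwards [Measure.ae_ne volume 0] with y hy0 hy using hpt y hy hy0
      _ = ((2 * Real.pi)⁻¹ * ∫ y in I, J y) * (2 * M + 1) ^ η := by
          rw [integral_const_mul, integral_const_mul]
          ring
      _ ≤ _ := by
          gcongr
          linarith

/-- The sharp cutoff to a cube costs an arbitrarily small power. -/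
lemma multBound_cube_cutoff (η : ℝ) (hη : 0 < η) :
    ∃ C : ℝ, 0 < C ∧ ∀ M : ℕ,
      MultBound (fun k => if ∀ a, |k a| ≤ M then 1 else 0) (C * (2 * M + 1) ^ η) := by
  -- The cube indicator is a product over three coordinates, each of which may cost a third of the
  -- exponent.
  obtain ⟨C, hC, h⟩ := multBound_coordinate_cutoff (η / 3) (by positivity)
  refine ⟨C * C * C, by positivity, fun M => ?_⟩
  have h3 := ((h 0 M).mul (h 1 M)).mul (h 2 M)
  have e1 : C * (2 * M + 1) ^ (η / 3) * (C * (2 * M + 1) ^ (η / 3)) * (C * (2 * M + 1) ^ (η / 3))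
      = C * C * C * (2 * (M : ℝ) + 1) ^ η := by
    have hM : (0 : ℝ) < 2 * M + 1 := by positivity
    have : (2 * (M : ℝ) + 1) ^ η = (2 * (M : ℝ) + 1) ^ (η / 3) * (2 * (M : ℝ) + 1) ^ (η / 3)
        * (2 * (M : ℝ) + 1) ^ (η / 3) := by
      rw [← Real.rpow_add hM, ← Real.rpow_add hM]
      congr 1
      ring
    rw [this]
    ring
  rw [e1] at h3
  convert h3 using 2 with k
  simp only [Fin.forall_fin_succ, ite_and, IsEmpty.forall_iff]
  split_ifs <;> simp_all

/-! ### Pointwise bounds on derivatives up to order two -/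

variable {E : Type*} [NormedAddCommGroup E] [NormedSpace ℝ E]

/-- `f` is `C²` at `x` and its derivatives of order at most two are bounded by `C` at `x`. -/
def DerivBound (f : E → ℝ) (x : E) (C : ℝ) : Prop :=
  ContDiffAt ℝ 2 f x ∧ ∀ i ≤ 2, ‖iteratedFDeriv ℝ i f x‖ ≤ C

lemma DerivBound.nonneg {f : E → ℝ} {x : E} {C : ℝ} (h : DerivBound f x C) : 0 ≤ C :=
  (norm_nonneg _).trans (h.2 0 (by norm_num))

lemma DerivBound.mono {f : E → ℝ} {x : E} {C C' : ℝ} (h : DerivBound f x C) (hC : C ≤ C') :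
    DerivBound f x C' :=
  ⟨h.1, fun i hi => (h.2 i hi).trans hC⟩

lemma DerivBound.abs_le {f : E → ℝ} {x : E} {C : ℝ} (h : DerivBound f x C) : |f x| ≤ C := by
  simpa using h.2 0 (by norm_num)

lemma _root_.ContDiffAt.exists_isOpen_contDiffOn_two {f : E → ℝ} {x : E} (h : ContDiffAt ℝ 2 f x) :
    ∃ u, IsOpen u ∧ x ∈ u ∧ ContDiffOn ℝ 2 f u := by
  obtain ⟨u, hu, hxu, h⟩ := ContDiffWithinAt.contDiffOn' (m := 2) le_rfl (by simp)
    (contDiffWithinAt_univ.2 h)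
  exact ⟨u, hu, hxu, by simpa using h⟩

lemma DerivBound.mul {f g : E → ℝ} {x : E} {A B : ℝ} (hf : DerivBound f x A)
    (hg : DerivBound g x B) : DerivBound (fun y => f y * g y) x (4 * (A * B)) := by
  refine ⟨hf.1.mul hg.1, fun n hn => ?_⟩
  obtain ⟨u, hu, hxu, hfu⟩ := hf.1.exists_isOpen_contDiffOn_two
  obtain ⟨v, hv, hxv, hgv⟩ := hg.1.exists_isOpen_contDiffOn_two
  have ho : IsOpen (u ∩ v) := hu.inter hv
  have hx : x ∈ u ∩ v := ⟨hxu, hxv⟩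
  have key := norm_iteratedFDerivWithin_mul_le (hfu.mono inter_subset_left)
    (hgv.mono inter_subset_right) ho.uniqueDiffOn hx (n := n) (by exact_mod_cast hn)
  simp_rw [iteratedFDerivWithin_of_isOpen _ ho hx] at key
  have hA := hf.nonneg
  have hB := hg.nonneg
  calc _ ≤ _ := key
    _ ≤ ∑ i ∈ Finset.range (n + 1), (n.choose i : ℝ) * A * B := by
        refine Finset.sum_le_sum fun i hi => ?_
        have hi' : i ≤ n := Nat.lt_succ_iff.1 (Finset.mem_range.1 hi)
        gcongr
        · exact hf.2 i (hi'.trans hn)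
        · exact hg.2 (n - i) ((Nat.sub_le n i).trans hn)
    _ = 2 ^ n * (A * B) := by
        simp_rw [mul_assoc]
        rw [← Finset.sum_mul]
        congr 1
        exact_mod_cast Nat.sum_range_choose n
    _ ≤ 4 * (A * B) := by
        gcongr
        calc (2 : ℝ) ^ n ≤ 2 ^ 2 := pow_le_pow_right₀ (by norm_num) hn
          _ = 4 := by norm_num

/-- Faà di Bruno in the form `n! C Dⁿ` requires the `i`-th inner derivative to be at most `Dⁱ`; with
`1 ≤ D` a single bound `D` serves for all orders. -/
lemma DerivBound.comp {φ : ℝ → ℝ} {h : E → ℝ} {x : E} {C D : ℝ} (hφ : ContDiff ℝ 2 φ)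
    (hb : DerivBound φ (h x) C) (hh : DerivBound h x D) (hD : 1 ≤ D) :
    DerivBound (fun y => φ (h y)) x (2 * C * D ^ 2) := by
  refine ⟨hφ.contDiffAt.comp x hh.1, fun n hn => ?_⟩
  obtain ⟨u, hu, hxu, hhu⟩ := hh.1.exists_isOpen_contDiffOn_two
  have hC := hb.nonneg
  have key := norm_iteratedFDerivWithin_comp_le (n := n) hφ.contDiffOn hhu (by exact_mod_cast hn)
    uniqueDiffOn_univ hu.uniqueDiffOn (mapsTo_univ _ _) hxu (C := C) (D := D)
    (fun i hi => by rw [iteratedFDerivWithin_univ]; exact hb.2 i (hi.trans hn))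
    (fun i h1 hi => by
      rw [iteratedFDerivWithin_of_isOpen _ hu hxu]
      exact (hh.2 i (hi.trans hn)).trans (le_self_pow₀ hD (by omega)))
  rw [iteratedFDerivWithin_of_isOpen _ hu hxu] at key
  refine key.trans ?_
  have h1 : (n.factorial : ℝ) ≤ 2 := by
    have : n.factorial ≤ Nat.factorial 2 := Nat.factorial_le hn
    exact_mod_cast this
  gcongr

lemma DerivBound.of_eventuallyEq_zero {f : E → ℝ} {x : E} {C : ℝ} (h : f =ᶠ[nhds x] fun _ => 0)
    (hC : 0 ≤ C) : DerivBound f x C := by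
  refine ⟨contDiffAt_const.congr_of_eventuallyEq h, fun i _ => ?_⟩
  rw [(Filter.EventuallyEq.iteratedFDeriv ℝ h i).eq_of_nhds]
  have : iteratedFDeriv ℝ i (fun _ : E => (0 : ℝ)) x = 0 := by
    have := congrFun (iteratedFDeriv_fun_zero (𝕜 := ℝ) (E := E) (F := ℝ) (n := i)) x
    exact this
  rw [this, norm_zero]
  exact hC

lemma exists_derivBound_of_isCompact {f : E → ℝ} (hf : ContDiff ℝ 2 f) {s : Set E}
    (hs : IsCompact s) : ∃ C : ℝ, 0 ≤ C ∧ ∀ x ∈ s, DerivBound f x C := by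
  have h : ∀ i ≤ 2, ∃ C : ℝ, ∀ x ∈ s, ‖iteratedFDeriv ℝ i f x‖ ≤ C := fun i hi =>
    hs.exists_bound_of_continuousOn
      (hf.continuous_iteratedFDeriv (by exact_mod_cast hi)).continuousOn
  obtain ⟨C₀, h₀⟩ := h 0 (by norm_num)
  obtain ⟨C₁, h₁⟩ := h 1 (by norm_num)
  obtain ⟨C₂, h₂⟩ := h 2 le_rfl
  refine ⟨|C₀| + |C₁| + |C₂|, by positivity, fun x hx => ⟨hf.contDiffAt, fun i hi => ?_⟩⟩
  have a₀ := le_abs_self C₀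
  have a₁ := le_abs_self C₁
  have a₂ := le_abs_self C₂
  interval_cases i
  · linarith [h₀ x hx, abs_nonneg C₁, abs_nonneg C₂]
  · linarith [h₁ x hx, abs_nonneg C₀, abs_nonneg C₂]
  · linarith [h₂ x hx, abs_nonneg C₀, abs_nonneg C₁]

lemma norm_iteratedFDeriv_comp_smul_le (f : E → ℝ) {l : ℝ} (hl : 0 < l) (x : E) (i : ℕ) :
    ‖iteratedFDeriv ℝ i (fun y => f (l • y)) x‖ ≤ l ^ i * ‖iteratedFDeriv ℝ i f (l • x)‖ := by
  set g : E ≃L[ℝ] E := ContinuousLinearEquiv.smulLeft (Units.mk0 l hl.ne') with hg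
  have h := g.iteratedFDerivWithin_comp_right (s := univ) f uniqueDiffOn_univ (mem_univ (g x)) i
  rw [preimage_univ, iteratedFDerivWithin_univ, iteratedFDerivWithin_univ] at h
  have h1 : (fun y => f (l • y)) = f ∘ g := rfl
  have h2 : g x = l • x := rfl
  rw [h1, h, h2]
  refine (ContinuousMultilinearMap.norm_compContinuousLinearMap_le _ _).trans ?_
  rw [mul_comm]
  refine mul_le_mul_of_nonneg_right ?_ (norm_nonneg _)
  rw [Finset.prod_const, Finset.card_univ, Fintype.card_fin]
  refine pow_le_pow_left₀ (norm_nonneg _) ?_ i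
  refine ContinuousLinearMap.opNorm_le_bound _ hl.le fun y => ?_
  change ‖l • y‖ ≤ l * ‖y‖
  rw [norm_smul, Real.norm_of_nonneg hl.le]

lemma _root_.ContDiffAt.comp_const_smul {f : E → ℝ} {l : ℝ} {x : E} (h : ContDiffAt ℝ 2 f (l • x)) :
    ContDiffAt ℝ 2 (fun y => f (l • y)) x :=
  ContDiffAt.comp x h (contDiff_const_smul l).contDiffAt

lemma DerivBound.comp_smul {f : E → ℝ} {l Λ : ℝ} {x : E} {C : ℝ} (hl : 0 < l) (hΛ : l ≤ Λ)
    (h1 : 1 ≤ Λ) (h : DerivBound f (l • x) C) : DerivBound (fun y => f (l • y)) x (Λ ^ 2 * C) := by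
  have hC := h.nonneg
  refine ⟨h.1.comp_const_smul, fun i hi => (norm_iteratedFDeriv_comp_smul_le f hl x i).trans ?_⟩
  have h2 : l ^ i ≤ Λ ^ 2 := (pow_le_pow_left₀ hl.le hΛ i).trans (pow_le_pow_right₀ h1 hi)
  exact mul_le_mul h2 (h.2 i hi) (norm_nonneg _) (by positivity)

/-- The mean value inequality is used twice: on the gradient, and then on `z ↦ f (z + v) - f z`
between `x - v` and `x`. -/
lemma abs_secondDifference_le {f : E → ℝ} (hf : ContDiff ℝ 2 f) {C : ℝ}
    (h : ∀ x, ‖iteratedFDeriv ℝ 2 f x‖ ≤ C) (x v : E) :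
    |f (x + v) + f (x + -v) - 2 * f x| ≤ C * ‖v‖ ^ 2 := by
  have hd : Differentiable ℝ f := hf.differentiable (by norm_num)
  have hd2 : Differentiable ℝ (fderiv ℝ f) :=
    (hf.fderiv_right (m := 1) (by norm_num)).differentiable (by norm_num)
  have h2 : ∀ x, ‖fderiv ℝ (fderiv ℝ f) x‖ ≤ C := fun x => by
    rw [← norm_iteratedFDeriv_one, norm_iteratedFDeriv_fderiv]
    exact h x
  have hlip : ∀ y, ‖fderiv ℝ f (y + v) - fderiv ℝ f y‖ ≤ C * ‖v‖ := fun y => by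
    have := convex_univ.norm_image_sub_le_of_norm_fderiv_le (𝕜 := ℝ) (f := fderiv ℝ f)
      (fun z _ => hd2 z) (fun z _ => h2 z) (mem_univ y) (mem_univ (y + v))
    simpa using this
  have hq : ∀ y, HasFDerivAt (fun z => f (z + v) - f z) (fderiv ℝ f (y + v) - fderiv ℝ f y) y :=
    fun y => ((hasFDerivAt_comp_add_right v).2 (hd (y + v)).hasFDerivAt).sub (hd y).hasFDerivAt
  have key := convex_univ.norm_image_sub_le_of_norm_hasFDerivWithin_le (𝕜 := ℝ)
    (fun z _ => (hq z).hasFDerivWithinAt) (fun z _ => hlip z) (mem_univ (x + -v)) (mem_univ x)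
  have e : f (x + v) - f x - (f (x + -v + v) - f (x + -v)) = f (x + v) + f (x + -v) - 2 * f x := by
    rw [neg_add_cancel_right]
    ring
  rw [e] at key
  calc _ ≤ C * ‖v‖ * ‖x - (x + -v)‖ := key
    _ = C * ‖v‖ ^ 2 := by
      rw [show x - (x + -v) = v by abel]
      ring

/-! ### Time regularity of the heat factor -/

lemma pow_mul_exp_neg_le {c r τ : ℝ} (hc : 0 < c) (hr : c ≤ r) (hτ : 0 ≤ τ) (n : ℕ) :
    τ ^ n * Real.exp (-τ * r) ≤ n.factorial / c ^ n := by
  have h := Real.pow_div_factorial_le_exp (x := τ * c) (by positivity) n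
  have hn : (0 : ℝ) < n.factorial := by positivity
  rw [div_le_iff₀ hn, mul_pow] at h
  rw [le_div_iff₀ (by positivity)]
  have h2 : Real.exp (-τ * r) * Real.exp (τ * c) ≤ 1 := by
    rw [← Real.exp_add, Real.exp_le_one_iff]
    nlinarith
  calc τ ^ n * Real.exp (-τ * r) * c ^ n = Real.exp (-τ * r) * (τ ^ n * c ^ n) := by ring
    _ ≤ Real.exp (-τ * r) * (Real.exp (τ * c) * n.factorial) := by gcongr
    _ = (Real.exp (-τ * r) * Real.exp (τ * c)) * n.factorial := by ring
    _ ≤ 1 * n.factorial := by gcongr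
    _ = n.factorial := one_mul _

/-- This interpolation, `min 1 x ≤ x ^ p`, turns a uniform bound and a Lipschitz bound into a Hölder
bound. -/
lemma le_rpow_of_le_one_of_le {x z p : ℝ} (hx : 0 < x) (hp : 0 ≤ p) (hp1 : p ≤ 1) (h1 : z ≤ 1)
    (h2 : z ≤ x) : z ≤ x ^ p := by
  rcases le_total 1 x with h | h
  · exact h1.trans (Real.one_le_rpow h hp)
  · refine h2.trans ?_
    calc x = x ^ (1 : ℝ) := (Real.rpow_one x).symm
      _ ≤ x ^ p := Real.rpow_le_rpow_of_exponent_ge hx h hp1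

/-- As a function of `τ ≥ 0`, `τⁿ e^{-τr}` is bounded because `r ≥ c > 0`, and Lipschitz because its
derivative costs at most a factor `r ≤ D`; the two are interpolated. The powers `τⁿ` are those
produced by differentiating the exponential in `r`. -/
lemma abs_pow_mul_exp_sub_le {c D : ℝ} (hc : 0 < c) :
    ∃ C : ℝ, 0 < C ∧ ∀ S T r p : ℝ, 0 < S → S < T → c ≤ r → r ≤ D → 0 ≤ p → p ≤ 1 → ∀ n ≤ 2,
      |T ^ n * Real.exp (-T * r) - S ^ n * Real.exp (-S * r)| ≤ C * (T - S) ^ p := by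
  set K : ℝ := 1 + 1 / c + 2 / c ^ 2 with hK
  have hK0 : 0 < K := by positivity
  have hle : ∀ τ r : ℝ, 0 ≤ τ → c ≤ r → ∀ n ≤ 2, τ ^ n * Real.exp (-τ * r) ≤ K := by
    intro τ r hτ hr n hn
    refine (pow_mul_exp_neg_le hc hr hτ n).trans ?_
    have h1 : 0 < 1 / c := by positivity
    have h2 : 0 < 2 / c ^ 2 := by positivity
    interval_cases n
    · simp only [Nat.factorial, pow_zero, Nat.cast_one, div_one, hK]
      linarith
    · simp only [Nat.factorial, pow_one, mul_one, Nat.succ_eq_add_one, zero_add, Nat.cast_one, hK]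
      linarith
    · simp only [Nat.factorial, hK]
      have h3 : 0 < c⁻¹ := inv_pos.2 hc
      norm_num
      linarith
  refine ⟨K * (2 + |D|), by positivity, fun S T r p hS hST hr hrD hp hp1 n hn => ?_⟩
  have hr0 : 0 < r := hc.trans_le hr
  have hT : 0 < T := hS.trans hST
  have b1 : |T ^ n * Real.exp (-T * r) - S ^ n * Real.exp (-S * r)| ≤ K * (2 + |D|) := by
    have hT1 := hle T r hT.le hr n hn
    have hS1 := hle S r hS.le hr n hn
    have hT2 : 0 ≤ T ^ n * Real.exp (-T * r) := by positivity
    have hS2 : 0 ≤ S ^ n * Real.exp (-S * r) := by positivity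
    have : |T ^ n * Real.exp (-T * r) - S ^ n * Real.exp (-S * r)| ≤ K :=
      abs_le.2 ⟨by linarith, by linarith⟩
    nlinarith [abs_nonneg D]
  have b2 : |T ^ n * Real.exp (-T * r) - S ^ n * Real.exp (-S * r)|
      ≤ K * (2 + |D|) * (T - S) := by
    have hder : ∀ τ ∈ Ici (0 : ℝ), HasDerivWithinAt (fun τ => τ ^ n * Real.exp (-τ * r))
        (n * τ ^ (n - 1) * Real.exp (-τ * r) + τ ^ n * (Real.exp (-τ * r) * (-1 * r)))
        (Ici 0) τ := fun τ _ => by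
      refine HasDerivAt.hasDerivWithinAt ?_
      exact (hasDerivAt_pow n τ).mul (((hasDerivAt_id τ).neg.mul_const r).exp)
    have hbd : ∀ τ ∈ Ici (0 : ℝ),
        ‖n * τ ^ (n - 1) * Real.exp (-τ * r) + τ ^ n * (Real.exp (-τ * r) * (-1 * r))‖
          ≤ K * (2 + |D|) := fun τ hτ => by
      have hτ0 : (0 : ℝ) ≤ τ := hτ
      have h1 := hle τ r hτ hr (n - 1) (by omega)
      have h2 := hle τ r hτ hr n hn
      have hn2 : (n : ℝ) ≤ 2 := by exact_mod_cast hn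
      have h3 : ‖n * τ ^ (n - 1) * Real.exp (-τ * r)‖ ≤ 2 * K := by
        rw [mul_assoc, Real.norm_of_nonneg (by positivity)]
        exact mul_le_mul hn2 h1 (by positivity) (by norm_num)
      have h4 : ‖τ ^ n * (Real.exp (-τ * r) * (-1 * r))‖ ≤ K * |D| := by
        rw [← mul_assoc, norm_mul, Real.norm_of_nonneg (by positivity)]
        refine mul_le_mul h2 ?_ (norm_nonneg _) hK0.le
        rw [neg_one_mul, norm_neg, Real.norm_of_nonneg hr0.le]
        exact hrD.trans (le_abs_self D)
      calc _ ≤ _ := norm_add_le _ _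
        _ ≤ _ := by linarith
    have key := (convex_Ici (0 : ℝ)).norm_image_sub_le_of_norm_hasDerivWithin_le hder hbd
      (mem_Ici.2 hS.le) (mem_Ici.2 hT.le)
    rw [Real.norm_eq_abs, Real.norm_of_nonneg (sub_nonneg.2 hST.le)] at key
    exact key
  have hpos : 0 < K * (2 + |D|) := by positivity
  rw [mul_comm (K * _), ← div_le_iff₀ hpos]
  refine le_rpow_of_le_one_of_le (sub_pos.2 hST) hp hp1 ?_ ?_
  · rwa [div_le_one hpos]
  · rw [div_le_iff₀ hpos, mul_comm (T - S)]
    exact b2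

lemma derivBound_exp_sub_exp {c D : ℝ} (hc : 0 < c) {p : ℝ} (hp : 0 ≤ p) (hp1 : p ≤ 1) :
    ∃ C : ℝ, 0 < C ∧ ∀ S T r : ℝ, 0 < S → S < T → c ≤ r → r ≤ D →
      DerivBound (fun r => Real.exp (-T * r) - Real.exp (-S * r)) r (C * (T - S) ^ p) := by
  obtain ⟨C, hC, h⟩ := abs_pow_mul_exp_sub_le (D := D) hc
  refine ⟨C, hC, fun S T r hS hST hr hrD => ⟨by fun_prop, fun i hi => ?_⟩⟩
  rw [norm_iteratedFDeriv_eq_norm_iteratedDeriv, iteratedDeriv_fun_sub (by fun_prop) (by fun_prop),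
    iteratedDeriv_exp_const_mul, iteratedDeriv_exp_const_mul, neg_pow, neg_pow S]
  simp only [mul_assoc]
  rw [← mul_sub, norm_mul, norm_pow, norm_neg, norm_one, one_pow, one_mul]
  exact h S T r p hS hST hr hrD hp hp1 i hi

/-! ### The rescaled symbol -/

lemma mem_cube_of_norm_le {r : ℝ} {x : E3} (h : ‖x‖ ≤ r) : x ∈ cube r := fun i =>
  (PiLp.norm_apply_le x i).trans h

lemma norm_le_of_mem_cube {r : ℝ} (hr : 0 ≤ r) {x : E3} (h : x ∈ cube r) : ‖x‖ ≤ 2 * r := by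
  rw [EuclideanSpace.norm_eq, Real.sqrt_le_left (by positivity)]
  calc ∑ i, ‖x i‖ ^ 2 ≤ ∑ _i : Fin 3, r ^ 2 :=
        Finset.sum_le_sum fun i _ => pow_le_pow_left₀ (norm_nonneg _) (h i) 2
    _ ≤ (2 * r) ^ 2 := by
        simp only [Finset.sum_const, Finset.card_univ, Fintype.card_fin, nsmul_eq_mul]
        norm_num
        nlinarith [sq_nonneg r]

/-- The second derivative of `f̃` may blow up like `|x|⁻¹`, but rescaling turns this into `l² |l
y|⁻¹ = l/|y|`, which is bounded away from `y = 0`. Uniformity in `l` holds because `a ≤ |y|` and `|l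
y| ≤ 3L₀` force `l ≤ 3L₀/a`. -/
lemma IsAdmissible.exists_derivBound {L₀ : ℝ} {ft : E3 → ℝ} (hft : IsAdmissible L₀ ft)
    {a : ℝ} (ha : 0 < a) (hL₀ : 0 < L₀) :
    ∃ C : ℝ, 0 ≤ C ∧ ∀ (l : ℝ) (y : E3), 0 < l → a ≤ ‖y‖ → ‖l • y‖ ≤ 3 * L₀ →
      DerivBound (fun z => ft (l • z)) y C := by
  obtain ⟨C, hC⟩ := hft.deriv_bound
  set Λ : ℝ := 3 * L₀ / a with hΛ
  have hΛ0 : 0 < Λ := by positivity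
  refine ⟨|C| * ((3 * L₀ + 1) + 2 * Λ + (Λ / a + Λ ^ 2)), by positivity, fun l y hl hay hly => ?_⟩
  have hy0 : 0 < ‖y‖ := ha.trans_le hay
  have hne : l • y ≠ 0 := smul_ne_zero hl.ne' (norm_pos_iff.1 hy0)
  have hmem := mem_cube_of_norm_le hly
  have hnorm : ‖l • y‖ = l * ‖y‖ := by rw [norm_smul, Real.norm_of_nonneg hl.le]
  have hlΛ : l ≤ Λ := by
    rw [hΛ, le_div_iff₀ ha]
    calc l * a ≤ l * ‖y‖ := by gcongr
      _ ≤ _ := hnorm ▸ hly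
  refine ⟨((hft.contDiffAt _ hmem hne).of_le (by norm_num)).comp_const_smul, fun i hi => ?_⟩
  refine (norm_iteratedFDeriv_comp_smul_le ft hl y i).trans ?_
  have h1 : ‖iteratedFDeriv ℝ i ft (l • y)‖ ≤ |C| * (‖l • y‖ ^ (1 - (i : ℤ)) + 1) :=
    (hC i (by omega) _ hmem hne).trans (by gcongr; exact le_abs_self C)
  have h2 : l ^ i * (‖l • y‖ ^ (1 - (i : ℤ)) + 1)
      ≤ (3 * L₀ + 1) + 2 * Λ + (Λ / a + Λ ^ 2) := by
    have p1 : 0 < Λ / a := by positivity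
    have p2 : 0 < Λ ^ 2 := by positivity
    interval_cases i
    · norm_num
      linarith
    · norm_num
      linarith
    · have e : l ^ 2 * (‖l • y‖ ^ (1 - ((2 : ℕ) : ℤ)) + 1) = l / ‖y‖ + l ^ 2 := by
        rw [hnorm]
        norm_num
        field_simp
      rw [e]
      have : l / ‖y‖ ≤ Λ / a := by gcongr
      have : l ^ 2 ≤ Λ ^ 2 := by gcongr
      linarith
  calc _ ≤ l ^ i * (|C| * (‖l • y‖ ^ (1 - (i : ℤ)) + 1)) := by gcongr
    _ = |C| * (l ^ i * (‖l • y‖ ^ (1 - (i : ℤ)) + 1)) := by ring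
    _ ≤ _ := by gcongr

/-- A smooth cutoff function equal to one on the ball of radius `2L₀` and supported in the ball of
radius `3L₀`. -/
def smoothCutoff {L₀ : ℝ} (hL₀ : 0 < L₀) : ContDiffBump (0 : E3) where
  -- The cube of half-side `L₀` lies in the ball of radius `2L₀`, as `√3 ≤ 2`, and the ball of
  -- radius `3L₀` lies in the cube where `f̃` is controlled.
  rIn := 2 * L₀
  rOut := 3 * L₀
  rIn_pos := by positivity
  rIn_lt_rOut := by linarith

/-- The rescaled symbol of `(P_T - P_S)` localised by `θ` and cut off smoothly by `ρ`. -/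
def heatSymbol (θ ft ρ : E3 → ℝ) (l S T : ℝ) (y : E3) : ℝ :=
  θ y * (ρ (l • y) *
    (Real.exp (-T * (‖y‖ ^ 2 * ft (l • y))) - Real.exp (-S * (‖y‖ ^ 2 * ft (l • y)))))

/-- Off the support of `θ`, or where `|l y| > 3L₀`, the symbol vanishes near the point. Elsewhere
the exponent lies in `[a²c, D]` with derivatives bounded by `D`, and the Leibniz and chain rules
transfer the Hölder bound in time from the exponentials to the whole symbol. -/
lemma derivBound_heatSymbol {θ : E3 → ℝ} (hθ : ContDiff ℝ 2 θ) {a b : ℝ} (ha : 0 < a)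
    (hab : tsupport θ ⊆ {x | a ≤ ‖x‖ ∧ ‖x‖ ≤ b}) {L₀ : ℝ} (hL₀ : 0 < L₀) {ft : E3 → ℝ}
    (hft : IsAdmissible L₀ ft) {p : ℝ} (hp : 0 ≤ p) (hp1 : p ≤ 1) :
    ∃ C : ℝ, 0 < C ∧ ∀ l S T : ℝ, 0 < l → 0 < S → S < T → ∀ y,
      DerivBound (heatSymbol θ ft (smoothCutoff hL₀) l S T) y (C * (T - S) ^ p) := by
  obtain ⟨c, hc, hcf⟩ := hft.lower_bound
  obtain ⟨Cθ, hCθ, hbθ⟩ := exists_derivBound_of_isCompact hθ (isCompact_closedBall (0 : E3) b)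
  obtain ⟨Cρ, hCρ, hbρ⟩ := exists_derivBound_of_isCompact
    ((smoothCutoff hL₀).contDiff (n := 2)) (isCompact_closedBall (0 : E3) (3 * L₀))
  obtain ⟨Cn, hCn, hbn⟩ := exists_derivBound_of_isCompact
    (f := fun y : E3 => ‖y‖ ^ 2) (contDiff_norm_sq ℝ) (isCompact_closedBall (0 : E3) b)
  obtain ⟨Cf, hCf, hbf⟩ := hft.exists_derivBound ha hL₀
  set D : ℝ := max 1 (4 * (Cn * Cf)) with hD
  have hD1 : 1 ≤ D := le_max_left _ _
  set Λ : ℝ := max 1 (3 * L₀ / a) with hΛ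
  obtain ⟨Ce, hCe, hbe⟩ := derivBound_exp_sub_exp (c := a ^ 2 * c) (D := D) (by positivity) hp hp1
  refine ⟨4 * (Cθ * (4 * ((Λ ^ 2 * Cρ) * (2 * Ce * D ^ 2)))) + 1, by positivity,
    fun l S T hl hS hST y => ?_⟩
  have hpow : 0 < (T - S) ^ p := Real.rpow_pos_of_pos (sub_pos.2 hST) p
  by_cases hy : y ∈ tsupport θ
  swap
  · refine DerivBound.of_eventuallyEq_zero ?_ (by positivity)
    filter_upwards [notMem_tsupport_iff_eventuallyEq.1 hy] with z hz
    simp [heatSymbol, hz]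
  by_cases hly : ‖l • y‖ ≤ 3 * L₀
  swap
  · refine DerivBound.of_eventuallyEq_zero ?_ (by positivity)
    have hopen : ∀ᶠ z in nhds y, 3 * L₀ < ‖l • z‖ :=
      (isOpen_lt continuous_const (by fun_prop)).mem_nhds (not_le.1 hly)
    filter_upwards [hopen] with z hz
    have : smoothCutoff hL₀ (l • z) = 0 :=
      (smoothCutoff hL₀).zero_of_le_dist (by rw [dist_zero_right]; exact hz.le)
    simp [heatSymbol, this]
  obtain ⟨hay, hyb⟩ := hab hy
  have hyball : y ∈ Metric.closedBall (0 : E3) b := by simpa using hyb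
  have hlball : l • y ∈ Metric.closedBall (0 : E3) (3 * L₀) := by simpa using hly
  have hlΛ : l ≤ Λ := by
    refine le_trans ?_ (le_max_right _ _)
    rw [le_div_iff₀ ha]
    calc l * a ≤ l * ‖y‖ := by gcongr
      _ = ‖l • y‖ := by rw [norm_smul, Real.norm_of_nonneg hl.le]
      _ ≤ _ := hly
  have hh : DerivBound (fun z => ‖z‖ ^ 2 * ft (l • z)) y D :=
    ((hbn y hyball).mul (hbf l y hl hay hly)).mono (le_max_right _ _)
  have hlow : a ^ 2 * c ≤ ‖y‖ ^ 2 * ft (l • y) := by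
    have := hcf _ (mem_cube_of_norm_le hly)
    gcongr
  have hup : ‖y‖ ^ 2 * ft (l • y) ≤ D := (le_abs_self _).trans hh.abs_le
  have hcomp := DerivBound.comp (h := fun z => ‖z‖ ^ 2 * ft (l • z)) (by fun_prop) (hbe S T _ hS hST hlow hup) hh hD1
  have hρ := (hbρ _ hlball).comp_smul hl hlΛ (le_max_left _ _)
  refine ((hbθ y hyball).mul (hρ.mul hcomp)).mono ?_
  have e : 4 * (Cθ * (4 * (Λ ^ 2 * Cρ * (2 * (Ce * (T - S) ^ p) * D ^ 2))))
      = 4 * (Cθ * (4 * (Λ ^ 2 * Cρ * (2 * Ce * D ^ 2)))) * (T - S) ^ p := by ring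
  rw [e, add_mul]
  linarith

/-! ### Multiplier bounds for the localised semigroup difference -/

lemma latticePt_add (k l : Z3) : latticePt (k + l) = latticePt k + latticePt l := by
  ext i
  simp [latticePt]

lemma latticePt_neg (k : Z3) : latticePt (-k) = -latticePt k := by
  ext i
  simp [latticePt]

lemma norm_latticePt_single (a : Fin 3) : ‖latticePt (Pi.single a 1)‖ = 1 := by
  have : latticePt (Pi.single a 1) = EuclideanSpace.single a (1 : ℝ) := by
    ext i
    by_cases h : i = a
    · subst h; simp [latticePt]
    · simp [latticePt, h]
  rw [this]
  simp

lemma abs_le_norm_latticePt (k : Z3) (a : Fin 3) : |(k a : ℝ)| ≤ ‖latticePt k‖ :=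
  PiLp.norm_apply_le (latticePt k) a

lemma semigroupSymbol_of_mem {L₀ : ℝ} {ft : E3 → ℝ} {ε t : ℝ} {k : Z3}
    (h : ε • latticePt k ∈ cube L₀) :
    semigroupSymbol L₀ ft ε t k =
      Real.exp (-t * (‖latticePt k‖ ^ 2 * ft (ε • latticePt k))) := by
  rw [semigroupSymbol, cutoff, if_pos h, ← EReal.coe_mul, ← EReal.coe_neg, EReal.exp_coe,
    ENNReal.toReal_ofReal (Real.exp_pos _).le]
  congr 1
  ring

/-- The origin lies in the cube, so here `k ≠ 0` and the ambiguous product `0 · ∞` does not arise.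
-/
lemma semigroupSymbol_of_notMem {L₀ : ℝ} (hL₀ : 0 < L₀) {ft : E3 → ℝ} {ε t : ℝ} (ht : 0 < t)
    {k : Z3} (h : ε • latticePt k ∉ cube L₀) : semigroupSymbol L₀ ft ε t k = 0 := by
  have hk : latticePt k ≠ 0 := by
    intro h0
    rw [h0, smul_zero] at h
    exact h fun i => by simpa using hL₀.le
  have hpos : 0 < t * ‖latticePt k‖ ^ 2 := by
    have := norm_pos_iff.2 hk
    positivity
  rw [semigroupSymbol, cutoff, if_neg h, EReal.coe_mul_top_of_pos hpos]
  simp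

lemma smul_latticePt_mem_cube_iff {L₀ ε : ℝ} (hε : 0 < ε) (hL₀ : 0 < L₀) (k : Z3) :
    ε • latticePt k ∈ cube L₀ ↔ ∀ a, |k a| ≤ (⌊L₀ / ε⌋₊ : ℤ) := by
  refine forall_congr' fun a => ?_
  have h1 : (ε • latticePt k) a = ε * k a := by simp [latticePt]
  rw [h1, abs_mul, abs_of_pos hε, mul_comm, ← le_div_iff₀ hε]
  have h2 : |(k a : ℝ)| = ((k a).natAbs : ℝ) := by
    rw [Nat.cast_natAbs, Int.cast_abs]
  rw [h2, ← Nat.le_floor_iff (by positivity), Int.abs_eq_natAbs, Nat.cast_le]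

lemma mul_rpow_half {N x δ : ℝ} (hN : 0 < N) (hx : 0 ≤ x) :
    (x * N ^ 2) ^ (δ / 2) = N ^ δ * x ^ (δ / 2) := by
  rw [Real.mul_rpow hx (by positivity), ← Real.rpow_natCast N 2, ← Real.rpow_mul hN.le, mul_comm]
  congr 2
  push_cast
  ring

/-- After scaling `k = N y` and time by `N²`, the symbol is a sharp cube indicator times a `C²`
function at scale `N`. The indicator costs `N^κ` and the smooth factor costs `((t-s) N²)^{δ/2} = N^δ
(t-s)^{δ/2}`. -/
lemma multBound_high_block {θ : E3 → ℝ} (hθ : ContDiff ℝ 2 θ) {a b : ℝ} (ha : 0 < a)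
    (hab : tsupport θ ⊆ {x | a ≤ ‖x‖ ∧ ‖x‖ ≤ b}) {L₀ : ℝ} (hL₀ : 0 < L₀) {ft : E3 → ℝ}
    (hft : IsAdmissible L₀ ft) {δ κ : ℝ} (hδ : 0 < δ) (hδ2 : δ ≤ 2) (hκ : 0 < κ) :
    ∃ C : ℝ, 0 < C ∧ ∀ N ε s t : ℝ, 1 ≤ N → 0 < ε → 0 < s → s < t →
      MultBound (fun k => ((θ (N⁻¹ • latticePt k) *
          (semigroupSymbol L₀ ft ε t k - semigroupSymbol L₀ ft ε s k) : ℝ) : ℂ))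
        (C * N ^ (κ + δ) * (t - s) ^ (δ / 2)) := by
  set b' : ℝ := max b 1 with hb'
  have hb'0 : 0 < b' := lt_max_of_lt_right one_pos
  obtain ⟨C₁, hC₁, h₁⟩ := derivBound_heatSymbol hθ ha hab hL₀ hft (p := δ / 2) (by linarith)
    (by linarith)
  obtain ⟨C₂, hC₂, h₂⟩ := multBound_of_second_difference b' hb'0.le
  obtain ⟨C₃, hC₃, h₃⟩ := multBound_cube_cutoff κ hκ
  refine ⟨C₃ * (2 * b' + 3) ^ κ * (C₂ * C₁), by positivity, fun N ε s t hN hε hs hst => ?_⟩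
  have hN0 : 0 < N := by linarith
  have hts : 0 < t - s := sub_pos.2 hst
  have hsT : s * N ^ 2 < t * N ^ 2 := by gcongr
  set Φ : E3 → ℝ := heatSymbol θ ft (smoothCutoff hL₀) (ε * N) (s * N ^ 2) (t * N ^ 2) with hΦ
  have hΦb : ∀ y, DerivBound Φ y (C₁ * (N ^ δ * (t - s) ^ (δ / 2))) := fun y => by
    have h := h₁ (ε * N) (s * N ^ 2) (t * N ^ 2) (by positivity) (by positivity) hsT y
    rwa [← sub_mul, mul_rpow_half hN0 hts.le] at h
  have hΦc : ContDiff ℝ 2 Φ := contDiff_iff_contDiffAt.2 fun y => (hΦb y).1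
  have hpowN : 0 < N ^ δ := Real.rpow_pos_of_pos hN0 _
  have hpowt : 0 < (t - s) ^ (δ / 2) := Real.rpow_pos_of_pos hts _
  have hθk : ∀ k : Z3, θ (N⁻¹ • latticePt k) ≠ 0 → ∀ a, |(k a : ℝ)| ≤ b' * N := fun k hk i => by
    have h := (hab (subset_tsupport _ hk)).2
    rw [norm_smul, norm_inv, Real.norm_of_nonneg hN0.le, inv_mul_le_iff₀ hN0] at h
    calc |(k i : ℝ)| ≤ N * b := (abs_le_norm_latticePt k i).trans h
      _ ≤ b' * N := by rw [mul_comm]; gcongr; exact le_max_left _ _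
  have hsmooth : MultBound (fun k => ((Φ (N⁻¹ • latticePt k) : ℝ) : ℂ))
      (C₂ * (C₁ * (N ^ δ * (t - s) ^ (δ / 2)))) := by
    refine h₂ N _ _ hN (by positivity) (fun k hk => hθk k fun h0 => hk ?_) (fun k => ?_)
      fun k i => ?_
    · simp [hΦ, heatSymbol, h0]
    · rw [Complex.norm_real]
      exact (hΦb _).abs_le
    · have h := abs_secondDifference_le hΦc (fun y => (hΦb y).2 2 le_rfl) (N⁻¹ • latticePt k)
        (N⁻¹ • latticePt (Pi.single i 1))
      rw [norm_smul, norm_latticePt_single, mul_one, norm_inv, Real.norm_of_nonneg hN0.le, inv_pow,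
        ← div_eq_mul_inv, ← smul_add, ← smul_neg, ← smul_add] at h
      rw [latticePt_add, latticePt_add, latticePt_neg, ← Complex.ofReal_add,
        show (2 : ℂ) = ((2 : ℝ) : ℂ) by norm_num, ← Complex.ofReal_mul, ← Complex.ofReal_sub,
        Complex.norm_real, Real.norm_eq_abs]
      exact h
  -- On the support of `θ(·/N)` a cube of half-side beyond `b' N` cuts nothing off. Truncating there
  -- keeps the cost at `N^κ` even when `ε` is tiny.
  set M : ℕ := min ⌊L₀ / ε⌋₊ ⌈b' * N⌉₊ with hM
  have hM1 : (2 * M + 1 : ℝ) ≤ (2 * b' + 3) * N := by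
    have h1 : (M : ℝ) ≤ ⌈b' * N⌉₊ := by exact_mod_cast min_le_right _ _
    have h2 := Nat.ceil_lt_add_one (a := b' * N) (by positivity)
    nlinarith
  have hprod := (h₃ M).mul hsmooth
  have hsymb : (fun k : Z3 => ((θ (N⁻¹ • latticePt k) *
      (semigroupSymbol L₀ ft ε t k - semigroupSymbol L₀ ft ε s k) : ℝ) : ℂ))
      = fun k : Z3 => (if ∀ a, |k a| ≤ (M : ℤ) then 1 else 0) *
        ((Φ (N⁻¹ • latticePt k) : ℝ) : ℂ) := by
    funext k
    by_cases hk : θ (N⁻¹ • latticePt k) = 0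
    · simp [hΦ, heatSymbol, hk]
    have hceil : ∀ i, |k i| ≤ (⌈b' * N⌉₊ : ℤ) := fun i => by
      have h : ((|k i| : ℤ) : ℝ) ≤ ((⌈b' * N⌉₊ : ℤ) : ℝ) := by
        rw [Int.cast_abs, Int.cast_natCast]
        exact (hθk k hk i).trans (Nat.le_ceil _)
      exact_mod_cast h
    have hiff : (∀ i, |k i| ≤ (M : ℤ)) ↔ ε • latticePt k ∈ cube L₀ := by
      rw [smul_latticePt_mem_cube_iff hε hL₀]
      refine forall_congr' fun i => ?_
      have := hceil i
      omega
    by_cases hcube : ε • latticePt k ∈ cube L₀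
    · rw [if_pos (hiff.2 hcube), one_mul, semigroupSymbol_of_mem hcube,
        semigroupSymbol_of_mem hcube]
      congr 1
      have e1 : (ε * N) • N⁻¹ • latticePt k = ε • latticePt k := by
        rw [smul_smul, mul_assoc, mul_inv_cancel₀ hN0.ne', mul_one]
      have e2 : smoothCutoff hL₀ (ε • latticePt k) = 1 :=
        (smoothCutoff hL₀).one_of_mem_closedBall (by
          rw [mem_closedBall_zero_iff]
          exact norm_le_of_mem_cube hL₀.le hcube)
      have e3 : ∀ τ F : ℝ, -(τ * N ^ 2) * (‖N⁻¹ • latticePt k‖ ^ 2 * F)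
          = -τ * (‖latticePt k‖ ^ 2 * F) := fun τ F => by
        rw [norm_smul, norm_inv, Real.norm_of_nonneg hN0.le]
        field_simp
      simp only [hΦ, heatSymbol, e1, e2, e3, one_mul]
    · rw [if_neg (fun h => hcube (hiff.1 h)), zero_mul,
        semigroupSymbol_of_notMem hL₀ (hs.trans hst) hcube, semigroupSymbol_of_notMem hL₀ hs hcube]
      simp
  rw [hsymb]
  refine hprod.mono ?_
  have hpowM : (2 * M + 1 : ℝ) ^ κ ≤ (2 * b' + 3) ^ κ * N ^ κ := by
    rw [← Real.mul_rpow (by positivity) hN0.le]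
    exact Real.rpow_le_rpow (by positivity) hM1 hκ.le
  rw [Real.rpow_add hN0]
  calc _ ≤ C₃ * ((2 * b' + 3) ^ κ * N ^ κ) * (C₂ * (C₁ * (N ^ δ * (t - s) ^ (δ / 2)))) := by
        gcongr
    _ = _ := by ring

lemma IsAdmissible.exists_bound {L₀ : ℝ} (hL₀ : 0 < L₀) {ft : E3 → ℝ} (hft : IsAdmissible L₀ ft) :
    ∃ C : ℝ, 1 ≤ C ∧ ∀ x ∈ cube L₀, ft x ≤ C := by
  obtain ⟨C, hC⟩ := hft.deriv_bound
  refine ⟨1 + |C| * (2 * L₀ + 1), by simp; positivity, fun x hx => ?_⟩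
  by_cases h0 : x = 0
  · rw [h0, hft.apply_zero]
    simp
    positivity
  have h := hC 0 (by norm_num) x (fun i => (hx i).trans (by linarith)) h0
  have h2 := norm_le_of_mem_cube hL₀.le hx
  norm_num at h
  calc ft x ≤ C * (‖x‖ + 1) := (le_abs_self _).trans h
    _ ≤ |C| * (2 * L₀ + 1) := by gcongr; exact le_abs_self C
    _ ≤ _ := by linarith

/-- On the finitely many modes seen by `χ` the exponent `A` is bounded by a constant `G`, so each
coefficient of the difference is at most `min(1, (t-s) G) ≤ ((t-s) G)^{δ/2}`. -/
lemma multBound_low_block {χ : E3 → ℝ} {R : ℝ} (hR : tsupport χ ⊆ {x | ‖x‖ ≤ R})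
    {L₀ : ℝ} (hL₀ : 0 < L₀) {ft : E3 → ℝ} (hft : IsAdmissible L₀ ft) {δ : ℝ} (hδ : 0 < δ)
    (hδ2 : δ ≤ 2) :
    ∃ C : ℝ, 0 < C ∧ ∀ ε s t : ℝ, 0 < s → s < t →
      MultBound (fun k => ((χ (latticePt k) *
          (semigroupSymbol L₀ ft ε t k - semigroupSymbol L₀ ft ε s k) : ℝ) : ℂ))
        (C * (t - s) ^ (δ / 2)) := by
  obtain ⟨F, hF1, hF⟩ := hft.exists_bound hL₀
  set s₀ := latticeBox ⌈R⌉₊ with hs₀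
  set G : ℝ := 1 + R ^ 2 * F with hG
  have hG0 : 0 < G := by positivity
  refine ⟨(∑ k ∈ s₀, |χ (latticePt k)|) * G ^ (δ / 2) + 1, by positivity,
    fun ε s t hs hst => ?_⟩
  have hts : 0 < t - s := sub_pos.2 hst
  have hpow : 0 < (t - s) ^ (δ / 2) := Real.rpow_pos_of_pos hts _
  have hχR : ∀ k, χ (latticePt k) ≠ 0 → ‖latticePt k‖ ≤ R := fun k hk => hR (subset_tsupport _ hk)
  refine (multBound_sum_norm s₀ _ fun k hk => ?_).mono ?_
  · have : χ (latticePt k) = 0 := by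
      by_contra h
      refine hk (mem_latticeBox.2 fun i => ?_)
      have h1 : ((|k i| : ℤ) : ℝ) ≤ ((⌈R⌉₊ : ℤ) : ℝ) := by
        rw [Int.cast_abs, Int.cast_natCast]
        exact ((abs_le_norm_latticePt k i).trans (hχR k h)).trans (Nat.le_ceil _)
      exact_mod_cast h1
    simp [this]
  · have hterm : ∀ k, ‖((χ (latticePt k) *
        (semigroupSymbol L₀ ft ε t k - semigroupSymbol L₀ ft ε s k) : ℝ) : ℂ)‖
        ≤ |χ (latticePt k)| * (G ^ (δ / 2) * (t - s) ^ (δ / 2)) := fun k => by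
      rw [Complex.norm_real, norm_mul, Real.norm_eq_abs, Real.norm_eq_abs]
      by_cases hk : χ (latticePt k) = 0
      · simp [hk]
      gcongr
      by_cases hcube : ε • latticePt k ∈ cube L₀
      · rw [semigroupSymbol_of_mem hcube, semigroupSymbol_of_mem hcube]
        set A := ‖latticePt k‖ ^ 2 * ft (ε • latticePt k) with hA
        have hA0 : 0 ≤ A := mul_nonneg (by positivity) (hft.nonneg _)
        have hAG : A ≤ G := by
          have h1 := hF _ hcube
          have h2 := hχR k hk
          have : A ≤ R ^ 2 * F := by
            rw [hA]
            exact mul_le_mul (pow_le_pow_left₀ (norm_nonneg _) h2 2) h1 (hft.nonneg _)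
              (by positivity)
          linarith
        have h1 : Real.exp (-t * A) ≤ Real.exp (-s * A) := by
          rw [Real.exp_le_exp]
          nlinarith
        have h2 : Real.exp (-s * A) ≤ 1 := by
          rw [Real.exp_le_one_iff]
          nlinarith
        have h3 : Real.exp (-t * A) = Real.exp (-s * A) * Real.exp (-((t - s) * A)) := by
          rw [← Real.exp_add]
          congr 1
          ring
        have h4 : 1 - (t - s) * A ≤ Real.exp (-((t - s) * A)) := by
          have := Real.add_one_le_exp (-((t - s) * A))
          linarith
        rw [abs_sub_comm, abs_of_nonneg (sub_nonneg.2 h1), mul_comm (G ^ _),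
          ← Real.mul_rpow hts.le hG0.le]
        refine le_rpow_of_le_one_of_le (by positivity) (by linarith) (by linarith) ?_ ?_
        · have := Real.exp_pos (-t * A)
          linarith
        · have h5 : (t - s) * A ≤ (t - s) * G := by gcongr
          have h6 := Real.exp_pos (-s * A)
          rw [h3]
          have h7 : 0 ≤ (t - s) * A := by positivity
          nlinarith
      · rw [semigroupSymbol_of_notMem hL₀ (hs.trans hst) hcube,
          semigroupSymbol_of_notMem hL₀ hs hcube, sub_zero, abs_zero]
        positivity
    calc _ ≤ ∑ k ∈ s₀, |χ (latticePt k)| * (G ^ (δ / 2) * (t - s) ^ (δ / 2)) :=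
          Finset.sum_le_sum fun k _ => hterm k
      _ = (∑ k ∈ s₀, |χ (latticePt k)|) * G ^ (δ / 2) * (t - s) ^ (δ / 2) := by
          rw [← Finset.sum_mul]
          ring
      _ ≤ _ := by
          gcongr
          linarith

lemma multBound_block {χ θ : E3 → ℝ} (hχθ : IsDyadicPartition χ θ) {L₀ : ℝ} (hL₀ : 0 < L₀)
    {ft : E3 → ℝ} (hft : IsAdmissible L₀ ft) {δ κ : ℝ} (hδ : 0 < δ) (hδ2 : δ ≤ 2) (hκ : 0 < κ) :
    ∃ C : ℝ, 0 < C ∧ ∀ (j : ℤ) (ε s t : ℝ), -1 ≤ j → 0 < ε → 0 < s → s < t →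
      MultBound (fun k => ((blockSymbol χ θ j k *
          (semigroupSymbol L₀ ft ε t k - semigroupSymbol L₀ ft ε s k) : ℝ) : ℂ))
        (C * (2 : ℝ) ^ ((j : ℝ) * (κ + δ)) * (t - s) ^ (δ / 2)) := by
  obtain ⟨a, b, ha, hab⟩ := hχθ.annulus_high
  obtain ⟨R, hR⟩ := hχθ.ball_low
  obtain ⟨C₁, hC₁, h₁⟩ := multBound_high_block (mod_cast contDiff_infty.1 hχθ.contDiff_high 2)
    ha hab hL₀ hft hδ hδ2 hκ
  obtain ⟨C₂, hC₂, h₂⟩ := multBound_low_block hR hL₀ hft hδ hδ2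
  -- The factor `2^{κ+δ}` compensates for the weight `2^{j(κ+δ)}` at `j = -1`.
  refine ⟨C₁ + C₂ * 2 ^ (κ + δ), by positivity, fun j ε s t hj hε hs hst => ?_⟩
  have hpow : 0 < (t - s) ^ (δ / 2) := Real.rpow_pos_of_pos (sub_pos.2 hst) _
  rcases eq_or_lt_of_le hj with h | h
  · subst h
    simp only [blockSymbol, if_true]
    refine (h₂ ε s t hs hst).mono ?_
    gcongr
    have e : C₂ = C₂ * 2 ^ (κ + δ) * (2 : ℝ) ^ (((-1 : ℤ) : ℝ) * (κ + δ)) := by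
      rw [mul_assoc, ← Real.rpow_add two_pos]
      simp
    calc C₂ = C₂ * 2 ^ (κ + δ) * (2 : ℝ) ^ (((-1 : ℤ) : ℝ) * (κ + δ)) := e
      _ ≤ _ := by
        gcongr
        linarith
  · simp only [blockSymbol, if_neg h.ne']
    have hN : (1 : ℝ) ≤ (2 : ℝ) ^ j := one_le_zpow₀ one_le_two (by omega)
    refine (h₁ _ ε s t hN hε hs hst).mono ?_
    have e : ((2 : ℝ) ^ j) ^ (κ + δ) = (2 : ℝ) ^ ((j : ℝ) * (κ + δ)) := by
      rw [Real.rpow_mul two_pos.le, Real.rpow_intCast]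
    rw [e]
    gcongr
    have : 0 ≤ C₂ * 2 ^ (κ + δ) := by positivity
    linarith

/-! ### Littlewood–Paley blocks of distributions -/

/-- A symbol that vanishes outside a finite set of lattice points. -/
def FinitelySupported (m : Z3 → ℝ) : Prop := ∃ s : Finset Z3, ∀ k ∉ s, m k = 0

lemma finitelySupported_of_bound {m : Z3 → ℝ} {R : ℝ} (h : ∀ k, m k ≠ 0 → ‖latticePt k‖ ≤ R) :
    FinitelySupported m := by
  refine ⟨latticeBox ⌈R⌉₊, fun k hk => ?_⟩
  by_contra hm
  refine hk (mem_latticeBox.2 fun i => ?_)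
  have h1 : ((|k i| : ℤ) : ℝ) ≤ ((⌈R⌉₊ : ℤ) : ℝ) := by
    rw [Int.cast_abs, Int.cast_natCast]
    exact ((abs_le_norm_latticePt k i).trans (h k hm)).trans (Nat.le_ceil _)
  exact_mod_cast h1

lemma fourierMultiplier_apply {m : Z3 → ℝ} {s : Finset Z3} (hm : ∀ k ∉ s, m k = 0)
    (u : distributions) (y : Fin 3 → ℝ) :
    (fourierMultiplier m u : E3 → ℂ) (WithLp.toLp 2 y)
      = ∑ k ∈ s, (m k : ℂ) * fourierCoeff u k * trigMode k y := by
  have h : fourierMultiplier m u = ∑ k ∈ s, ((m k : ℂ) * fourierCoeff u k) • mode k := by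
    refine finsum_eq_sum_of_support_subset _ fun k hk => ?_
    by_contra hks
    exact hk (by simp [hm k hks])
  rw [h, Submodule.coe_sum, Finset.sum_apply]
  refine Finset.sum_congr rfl fun k _ => ?_
  rw [Submodule.coe_smul, Pi.smul_apply, smul_eq_mul, mode_toLp]

/-- Orthogonality of the modes on a period box recovers the coefficients of a trigonometric
polynomial. Finite support is essential: otherwise the `finsum` could take its default value zero.
-/
lemma fourierCoeff_toDistribution {m : Z3 → ℝ} (hm : FinitelySupported m) (u : distributions)
    (k : Z3) :
    fourierCoeff (toDistribution (fourierMultiplier m u)) k = m k * fourierCoeff u k := by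
  obtain ⟨s, hs⟩ := hm
  have hpre : WithLp.toLp 2 ⁻¹' fundBox = box 0 := by
    ext y
    simp [fundBox, box, Pi.le_def, forall_and]
  have h1 : ∫ x in fundBox, (fourierMultiplier m u : E3 → ℂ) x * (mode (-k) : E3 → ℂ) x
      = ∫ y in box 0, (∑ l ∈ s, (m l : ℂ) * fourierCoeff u l * trigMode l y) * trigMode (-k) y := by
    rw [← hpre, ← (PiLp.volume_preserving_toLp (Fin 3)).setIntegral_preimage_emb
      (MeasurableEquiv.toLp 2 (Fin 3 → ℝ)).measurableEmbedding]
    refine integral_congr_ae (ae_of_all _ fun y => ?_)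
    simp only [fourierMultiplier_apply hs, mode_toLp]
  have hpi : (((2 * Real.pi) ^ 3 : ℝ) : ℂ) ≠ 0 := by
    have := Real.pi_pos
    exact_mod_cast (by positivity : (2 * Real.pi) ^ 3 ≠ 0)
  change _ * ∫ x in fundBox, (fourierMultiplier m u : E3 → ℂ) x * (mode (-k) : E3 → ℂ) x = _
  rw [h1, integral_trigSum_mul]
  split_ifs with h
  · rw [inv_mul_cancel_left₀ hpi]
  · simp [hs k h]

lemma fourierCoeff_sub (u v : distributions) (k : Z3) :
    fourierCoeff (u - v) k = fourierCoeff u k - fourierCoeff v k := by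
  simp [fourierCoeff, mul_sub]

lemma finitelySupported_semigroupSymbol {L₀ : ℝ} (hL₀ : 0 < L₀) (ft : E3 → ℝ) {ε t : ℝ}
    (hε : 0 < ε) (ht : 0 < t) : FinitelySupported (semigroupSymbol L₀ ft ε t) := by
  refine ⟨latticeBox ⌊L₀ / ε⌋₊, fun k hk => semigroupSymbol_of_notMem hL₀ ht fun h => hk ?_⟩
  exact mem_latticeBox.2 ((smul_latticePt_mem_cube_iff hε hL₀ k).1 h)

lemma finitelySupported_blockSymbol {χ θ : E3 → ℝ} (hχθ : IsDyadicPartition χ θ) (j : ℤ) :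
    FinitelySupported (blockSymbol χ θ j) := by
  obtain ⟨a, b, ha, hab⟩ := hχθ.annulus_high
  obtain ⟨R, hR⟩ := hχθ.ball_low
  by_cases hj : j = -1
  · refine finitelySupported_of_bound (R := R) fun k hk => ?_
    rw [blockSymbol, if_pos hj] at hk
    exact hR (subset_tsupport _ hk)
  · refine finitelySupported_of_bound (R := 2 ^ j * b) fun k hk => ?_
    rw [blockSymbol, if_neg hj] at hk
    have h := (hab (subset_tsupport _ hk)).2
    have hN : (0 : ℝ) < 2 ^ j := by positivity
    rwa [norm_smul, norm_inv, Real.norm_of_nonneg hN.le, inv_mul_le_iff₀ hN] at h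

lemma hasSum_blockSymbol {χ θ : E3 → ℝ} (hχθ : IsDyadicPartition χ θ) (k : Z3) :
    HasSum (fun n : ℕ => blockSymbol χ θ ((n : ℤ) - 1) k) 1 := by
  have h := hχθ.sum_eq_one (latticePt k)
  have h2 : HasSum (fun n : ℕ => blockSymbol χ θ (((n + 1 : ℕ) : ℤ) - 1) k)
      (1 - χ (latticePt k)) := by
    convert h using 2 with n
    rw [blockSymbol, if_neg (by omega)]
    push_cast
    rw [add_sub_cancel_right, zpow_natCast]
  rw [hasSum_nat_add_iff (f := fun n : ℕ => blockSymbol χ θ ((n : ℤ) - 1) k) 1] at h2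
  simpa [blockSymbol] using h2

lemma blockSymbol_eq_zero_of_far {χ θ : E3 → ℝ} (hχθ : IsDyadicPartition χ θ) {m n : ℕ}
    (hmn : m + 1 < n) (k : Z3) (hm : blockSymbol χ θ ((m : ℤ) - 1) k ≠ 0) :
    blockSymbol χ θ ((n : ℤ) - 1) k = 0 := by
  by_contra hn
  obtain ⟨n, rfl⟩ : ∃ n', n = n' + 1 := ⟨n - 1, by omega⟩
  have e : ∀ l : ℕ, blockSymbol χ θ (((l + 1 : ℕ) : ℤ) - 1) k
      = θ (((2 : ℝ) ^ l)⁻¹ • latticePt k) := fun l => by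
    rw [blockSymbol, if_neg (by omega)]
    push_cast
    rw [add_sub_cancel_right, zpow_natCast]
  rw [e] at hn
  have hn' : latticePt k ∈ tsupport fun x => θ (((2 : ℝ) ^ n)⁻¹ • x) := subset_tsupport _ hn
  rcases m with _ | m
  · simp only [blockSymbol, Nat.cast_zero, zero_sub, if_true] at hm
    exact (hχθ.disjoint_low n (by omega)).le_bot ⟨subset_tsupport _ hm, hn'⟩
  · rw [e] at hm
    have hm' : latticePt k ∈ tsupport fun x => θ (((2 : ℝ) ^ m)⁻¹ • x) := subset_tsupport _ hm
    exact (hχθ.disjoint_high m n (by omega)).le_bot ⟨hm', hn'⟩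

/-- Only neighbouring blocks interact. -/
lemma blockSymbol_mul_sum {χ θ : E3 → ℝ} (hχθ : IsDyadicPartition χ θ) (n : ℕ) (k : Z3) :
    blockSymbol χ θ ((n : ℤ) - 1) k *
        ∑ i ∈ Finset.Icc (n - 1) (n + 1), blockSymbol χ θ ((i : ℤ) - 1) k
      = blockSymbol χ θ ((n : ℤ) - 1) k := by
  by_cases h : blockSymbol χ θ ((n : ℤ) - 1) k = 0
  · rw [h, zero_mul]
  -- Blocks are indexed by `n = j + 1`. For `n = 0` truncated subtraction shrinks the window to `{0,
  -- 1}`, as it should, since the block `j = -1` has no lower neighbour.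
  have hfin : HasSum (fun i : ℕ => blockSymbol χ θ ((i : ℤ) - 1) k)
      (∑ i ∈ Finset.Icc (n - 1) (n + 1), blockSymbol χ θ ((i : ℤ) - 1) k) := by
    refine hasSum_sum_of_ne_finset_zero fun i hi => ?_
    rw [Finset.mem_Icc] at hi
    by_cases hlt : n + 1 < i
    · exact blockSymbol_eq_zero_of_far hχθ hlt k h
    · by_contra h0
      exact h (blockSymbol_eq_zero_of_far hχθ (by omega) k h0)
  rw [hfin.unique (hasSum_blockSymbol hχθ k), mul_one]

/-- The Hölder–Besov norm of a single distribution. -/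
def componentNorm (χ θ : E3 → ℝ) (β : ℝ) (u : distributions) : ℝ≥0∞ :=
  ⨆ (j : ℤ) (_ : -1 ≤ j), ENNReal.ofReal ((2 : ℝ) ^ ((j : ℝ) * β)) * supNorm (block χ θ j u)

lemma norm_block_le {χ θ : E3 → ℝ} {β : ℝ} {u : distributions}
    (h : componentNorm χ θ β u ≠ ⊤) {j : ℤ} (hj : -1 ≤ j) (x : E3) :
    ‖(block χ θ j u : E3 → ℂ) x‖
      ≤ (2 : ℝ) ^ (-((j : ℝ) * β)) * (componentNorm χ θ β u).toReal := by
  have h1 : ENNReal.ofReal ((2 : ℝ) ^ ((j : ℝ) * β)) * ‖(block χ θ j u : E3 → ℂ) x‖ₑ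
      ≤ componentNorm χ θ β u :=
    (mul_le_mul_right (le_iSup (fun x => ‖(block χ θ j u : E3 → ℂ) x‖ₑ) x) _).trans
      (le_iSup₂ (f := fun (j : ℤ) (_ : -1 ≤ j) => ENNReal.ofReal ((2 : ℝ) ^ ((j : ℝ) * β)) *
        supNorm (block χ θ j u)) j hj)
  have h2 := ENNReal.toReal_mono h h1
  have hpos : (0 : ℝ) < 2 ^ ((j : ℝ) * β) := by positivity
  rw [ENNReal.toReal_mul, ENNReal.toReal_ofReal hpos.le, toReal_enorm] at h2
  rw [Real.rpow_neg two_pos.le, ← div_eq_inv_mul, le_div_iff₀ hpos, mul_comm]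
  exact h2

/-- This bounds the fattened block to which the multiplier is applied: at most three neighbours
contribute, and moving the index by one changes the weight by at most `2^{|β|}`. -/
lemma norm_trigSum_block_le {χ θ : E3 → ℝ} {β : ℝ} {u : distributions}
    (h : componentNorm χ θ β u ≠ ⊤) (n : ℕ) {s : Finset Z3}
    (hs : ∀ i ∈ Finset.Icc (n - 1) (n + 1), ∀ k ∉ s, blockSymbol χ θ ((i : ℤ) - 1) k = 0)
    (y : Fin 3 → ℝ) :
    ‖∑ k ∈ s, ((∑ i ∈ Finset.Icc (n - 1) (n + 1), blockSymbol χ θ ((i : ℤ) - 1) k : ℝ) : ℂ) *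
        fourierCoeff u k * trigMode k y‖
      ≤ 3 * 2 ^ |β| * 2 ^ (-((((n : ℤ) - 1 : ℤ) : ℝ) * β)) * (componentNorm χ θ β u).toReal := by
  set B := (componentNorm χ θ β u).toReal with hB
  have hB0 : 0 ≤ B := ENNReal.toReal_nonneg
  have e : ∑ k ∈ s, ((∑ i ∈ Finset.Icc (n - 1) (n + 1), blockSymbol χ θ ((i : ℤ) - 1) k : ℝ) : ℂ) *
        fourierCoeff u k * trigMode k y
      = ∑ i ∈ Finset.Icc (n - 1) (n + 1),
        (block χ θ ((i : ℤ) - 1) u : E3 → ℂ) (WithLp.toLp 2 y) := by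
    simp only [block]
    rw [Finset.sum_congr rfl fun i hi => fourierMultiplier_apply (hs i hi) u y, Finset.sum_comm]
    refine Finset.sum_congr rfl fun k _ => ?_
    rw [Complex.ofReal_sum, Finset.sum_mul, Finset.sum_mul]
  rw [e]
  have hterm : ∀ i ∈ Finset.Icc (n - 1) (n + 1),
      ‖(block χ θ ((i : ℤ) - 1) u : E3 → ℂ) (WithLp.toLp 2 y)‖
        ≤ 2 ^ |β| * 2 ^ (-((((n : ℤ) - 1 : ℤ) : ℝ) * β)) * B := fun i hi => by
    refine (norm_block_le h (by omega) _).trans ?_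
    rw [← Real.rpow_add two_pos]
    gcongr
    · exact one_le_two
    · rw [Finset.mem_Icc] at hi
      have h1 : |((n : ℝ) - i)| ≤ 1 := by
        have : |((n : ℤ) - i)| ≤ 1 := by rw [abs_le]; omega
        exact_mod_cast this
      have h2 : ((n : ℝ) - i) * β ≤ |β| := by
        calc ((n : ℝ) - i) * β ≤ |((n : ℝ) - i) * β| := le_abs_self _
          _ = |((n : ℝ) - i)| * |β| := abs_mul _ _
          _ ≤ 1 * |β| := by gcongr
          _ = |β| := one_mul _
      push_cast
      linarith
  calc _ ≤ ∑ i ∈ Finset.Icc (n - 1) (n + 1), 2 ^ |β| * 2 ^ (-((((n : ℤ) - 1 : ℤ) : ℝ) * β)) * B :=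
        norm_sum_le_of_le _ hterm
    _ = (Finset.Icc (n - 1) (n + 1)).card * (2 ^ |β| * 2 ^ (-((((n : ℤ) - 1 : ℤ) : ℝ) * β)) * B) := by
        rw [Finset.sum_const, nsmul_eq_mul]
    _ ≤ 3 * (2 ^ |β| * 2 ^ (-((((n : ℤ) - 1 : ℤ) : ℝ) * β)) * B) := by
        gcongr
        rw [Nat.card_Icc]
        exact_mod_cast (by omega : n + 1 + 1 - (n - 1) ≤ 3)
    _ = _ := by ring

/-! ### The estimate for one component -/

lemma componentNorm_semigroup_sub_le {χ θ : E3 → ℝ} (hχθ : IsDyadicPartition χ θ) {L₀ : ℝ}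
    (hL₀ : 0 < L₀) {ft : E3 → ℝ} (hft : IsAdmissible L₀ ft) {α δ κ : ℝ} (hδ : 0 < δ) (hδ2 : δ ≤ 2)
    (hκ : 0 < κ) :
    ∃ C : ℝ, 0 < C ∧ ∀ (u : distributions) (ε s t : ℝ), 0 < ε → 0 < s → s < t →
      componentNorm χ θ (α - κ) (approxSemigroup L₀ ft ε t u - approxSemigroup L₀ ft ε s u)
        ≤ ENNReal.ofReal (C * (t - s) ^ (δ / 2)) * componentNorm χ θ (α + δ) u := by
  obtain ⟨C, hC, hmult⟩ := multBound_block hχθ hL₀ hft hδ hδ2 hκ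
  refine ⟨C * (3 * 2 ^ |α + δ|), by positivity, fun u ε s t hε hs hst => ?_⟩
  have ht : 0 < t := hs.trans hst
  have hpow : 0 < (t - s) ^ (δ / 2) := Real.rpow_pos_of_pos (sub_pos.2 hst) _
  -- An infinite norm of `u` makes the right-hand side infinite, because the factor in front is
  -- positive.
  by_cases htop : componentNorm χ θ (α + δ) u = ⊤
  · rw [htop, ENNReal.mul_top]
    · exact le_top
    · simp only [ne_eq, ENNReal.ofReal_eq_zero, not_le]
      positivity
  set B := (componentNorm χ θ (α + δ) u).toReal with hB
  have hB0 : 0 ≤ B := ENNReal.toReal_nonneg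
  set w := approxSemigroup L₀ ft ε t u - approxSemigroup L₀ ft ε s u with hw
  have hcoeff : ∀ k, fourierCoeff w k
      = ((semigroupSymbol L₀ ft ε t k - semigroupSymbol L₀ ft ε s k : ℝ) : ℂ) *
        fourierCoeff u k := fun k => by
    rw [hw, fourierCoeff_sub, approxSemigroup, approxSemigroup,
      fourierCoeff_toDistribution (finitelySupported_semigroupSymbol hL₀ ft hε ht),
      fourierCoeff_toDistribution (finitelySupported_semigroupSymbol hL₀ ft hε hs),
      Complex.ofReal_sub, sub_mul]
  choose S hS using finitelySupported_blockSymbol hχθ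
  refine iSup₂_le fun j hj => ?_
  obtain ⟨n, rfl⟩ : ∃ n : ℕ, j = (n : ℤ) - 1 := ⟨(j + 1).toNat, by omega⟩
  set s₀ : Finset Z3 := (Finset.Icc (n - 1) (n + 1)).biUnion fun i => S ((i : ℤ) - 1) with hs₀
  have hs₀z : ∀ i ∈ Finset.Icc (n - 1) (n + 1), ∀ k ∉ s₀, blockSymbol χ θ ((i : ℤ) - 1) k = 0 :=
    fun i hi k hk => hS _ k fun hk' => hk (Finset.mem_biUnion.2 ⟨i, hi, hk'⟩)
  have hval : ∀ y, ‖(block χ θ ((n : ℤ) - 1) w : E3 → ℂ) (WithLp.toLp 2 y)‖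
      ≤ C * 2 ^ ((((n : ℤ) - 1 : ℤ) : ℝ) * (κ + δ)) * (t - s) ^ (δ / 2) *
        (3 * 2 ^ |α + δ| * 2 ^ (-((((n : ℤ) - 1 : ℤ) : ℝ) * (α + δ))) * B) := fun y => by
    have h := hmult ((n : ℤ) - 1) ε s t hj hε hs hst s₀ _ _ (norm_trigSum_block_le htop n hs₀z) y
    rw [block, fourierMultiplier_apply (hs₀z n (by rw [Finset.mem_Icc]; omega))]
    refine le_trans (le_of_eq ?_) h
    congr 1
    refine Finset.sum_congr rfl fun k _ => ?_
    rw [hcoeff]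
    -- Inserting the fattened block leaves the block symbol unchanged, which lets the multiplier act
    -- on a function controlled by the norm of `u`.
    have e := blockSymbol_mul_sum hχθ n k
    rw [← mul_assoc, ← mul_assoc, ← Complex.ofReal_mul, ← Complex.ofReal_mul, mul_right_comm _ _
      (∑ i ∈ _, _), e]
  rw [← ENNReal.ofReal_toReal htop, ← hB, ← ENNReal.ofReal_mul (by positivity)]
  have hsup : supNorm (block χ θ ((n : ℤ) - 1) w)
      ≤ ENNReal.ofReal (C * 2 ^ ((((n : ℤ) - 1 : ℤ) : ℝ) * (κ + δ)) * (t - s) ^ (δ / 2) *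
        (3 * 2 ^ |α + δ| * 2 ^ (-((((n : ℤ) - 1 : ℤ) : ℝ) * (α + δ))) * B)) := by
    refine iSup_le fun x => ?_
    rw [← ofReal_norm]
    exact ENNReal.ofReal_le_ofReal (hval x.ofLp)
  refine (mul_le_mul_right hsup _).trans (le_of_eq ?_)
  rw [← ENNReal.ofReal_mul (by positivity)]
  congr 1
  set r : ℝ := (((n : ℤ) - 1 : ℤ) : ℝ) with hr
  -- The exponents cancel exactly: `(α - κ) + (κ + δ) - (α + δ) = 0`.
  have hexp : (2 : ℝ) ^ (r * (α - κ)) * 2 ^ (r * (κ + δ)) * 2 ^ (-(r * (α + δ))) = 1 := by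
    rw [← Real.rpow_add two_pos, ← Real.rpow_add two_pos]
    ring_nf
    simp
  linear_combination (C * (t - s) ^ (δ / 2) * (3 * 2 ^ |α + δ|) * B) * hexp

end TorusBesov

end

theorem lemma3p4
    (χ θ : TorusBesov.E3 → ℝ) (hχθ : TorusBesov.IsDyadicPartition χ θ)
    (L₀ : ℝ) (hL₀ : 0 < L₀)
    (ft : TorusBesov.E3 → ℝ) (hft : TorusBesov.IsAdmissible L₀ ft)
    (α δ κ : ℝ) (hδ : 0 < δ) (hδ2 : δ ≤ 2) (hκ : 0 < κ) :
    ∃ C : ℝ, 0 < C ∧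
      ∀ (n : ℕ) (u : Fin n → TorusBesov.distributions),
        TorusBesov.MemHolderBesov χ θ (α + δ) u →
        ∀ ε : ℝ, 0 < ε → ε < 1 → ∀ s t : ℝ, 0 < s → s < t →
          TorusBesov.besovNorm χ θ (α - κ)
              (fun i => TorusBesov.approxSemigroup L₀ ft ε t (u i)
                - TorusBesov.approxSemigroup L₀ ft ε s (u i))
            ≤ ENNReal.ofReal (C * (t - s) ^ (δ / 2)) * TorusBesov.besovNorm χ θ (α + δ) u := by
  obtain ⟨C, hC, h⟩ := TorusBesov.componentNorm_semigroup_sub_le (α := α) hχθ hL₀ hft hδ hδ2 hκ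
  refine ⟨C, hC, fun n u _ ε hε _ s t hs hst => ?_⟩
  rw [TorusBesov.besovNorm, TorusBesov.besovNorm, Finset.mul_sum]
  exact Finset.sum_le_sum fun i _ => h (u i) ε s t hε hs hst
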